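/- Let $n\ge 1$, let $T$ be the set of transpositions of $S_n$, let $\ell_T(\pi)$ be the least number of factors in an expression of $\pi\in S_n$ as a product of transpositions, and let $c=(1,2,\ldots,n)$; products of permutations are compositions of functions, the rightmost factor acting first. Let $NC(n)=\{\pi\in S_n:\ell_T(\pi)+\ell_T(\pi^{-1}c)=\ell_T(c)\}$, ordered by $\pi\le\sigma\iff\ell_T(\pi)+\ell_T(\pi^{-1}\sigma)=\ell_T(\sigma)$, and let $F_n$ be the set of maximal chains of $NC(n)$. A factorization $c=t_1\cdots t_{n-1}$ with all $t_i\in T$ is identified with the maximal chain $1<t_1<t_1t_2<\cdots<t_1\cdots t_{n-1}=c$; this is a bijection of the set of such factorizations $(t_1,\ldots,t_{n-1})$ with $F_n$. Let $G_T(n)$ be the graph on $F_n$ in which two chains are adjacent if they differ in exactly one element, and let $e=((1,2),(2,3),\ldots,(n-1,n))\in F_n$. The weak order on $F_n$ is defined by: $u\le v$ if $u$ lies on a geodesic of $G_T(n)$ from $e$ to $v$. Write $\mathrm{Weak}(F_n)$ for $F_n$ with this relation, $u<v$ for $u\le v$, $u\neq v$, and $[e,w]=\{v: e\le v\le w\}$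 for the lower interval of $w\in F_n$. For $w=(t_1,\ldots,t_{n-1})\in F_n$ and $1\le i\le n-2$ put $R_i(w)=(\ldots,t_{i-1},\,t_i^{-1}t_{i+1}t_i,\,t_i,\,t_{i+2},\ldots)$ and $L_i(w)=(\ldots,t_{i-1},\,t_{i+1},\,t_{i+1}^{-1}t_it_{i+1},\,t_{i+2},\ldots)$. Let $\sigma_j=t_j t_{j+1}\cdots t_{n-1}$ for $1\le j\le n-1$ and $\sigma_n=\mathrm{id}$. For each $1\le j\le n-1$ there is exactly one $i\in\{1,\ldots,n-1\}$ with $\sigma_j(i)>\sigma_{j+1}(i)$; denote it by $\phi(w)(j)$. Then $\phi(w)\in S_{n-1}$. The down operator $D_i:F_n\to F_n$ $(1\le i\le n-2)$ is defined by: if $\phi(w)(i)>\phi(w)(i+1)$, then $D_i(w)=R_i(w)$ if $R_i(w)<w$, and $D_i(w)=L_i(w)$ if $L_i(w)<w$; otherwise $D_i(w)=w$. The $0$-Hecke algebra $\mathcal H_{n-1}(0)$ is the unital associative $\mathbb Q$-algebra with generators $T_1,\ldots,T_{n-2}$ and relations $T_i^2=T_i$, $T_iT_j=T_jT_i$ for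 $|i-j|>1$, and $T_iT_{i+1}T_i=T_{i+1}T_iT_{i+1}$ for $1\le i\le n-3$. Theorem. (0) $\mathrm{Weak}(F_n)$ is a partially ordered set, and the $D_i$ are well defined: if $\phi(w)(i)>\phi(w)(i+1)$, then $R_i(w)<w$ or $L_i(w)<w$, and if both hold then $R_i(w)=L_i(w)$. (1) The operators $D_i$ satisfy the relations of $\mathcal H_{n-1}(0)$: $D_i^2=D_i$ for all $i$, $D_iD_j=D_jD_i$ for $|i-j|>1$, and $D_iD_{i+1}D_i=D_{i+1}D_iD_{i+1}$ for $1\le i\le n-3$. (2) There is a homomorphism of unital $\mathbb Q$-algebras $\rho:\mathcal H_{n-1}(0)\to\mathrm{End}_{\mathbb Q}(\mathbb Q F_n)$ with $\rho(T_i)(w)=D_i(w)$ for all $w\in F_n$ and $1\le i\le n-2$, where $\mathbb Q F_n$ is the vector space with basis $F_n$; and it is injective, that is, the action of $\mathcal H_{n-1}(0)$ is faithful. (3) Every lower interval is invariant: for all $w\in F_n$, $D_i([e,w])\subseteq[e,w]$ for every $i$, and $\rho(x)$ maps the span of $[e,w]$ in $\mathbb Q F_n$ into itself for every $x\in\mathcal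 H_{n-1}(0)$. -/

import Mathlib

open Equiv

namespace NoncrossingChains

/-! ### Reflection length, the noncrossing partition lattice, and its maximal chains

The symmetric group on `1, ..., n` is `Perm (Fin n)`, its letters being shifted to `0, ..., n - 1`.
Products are compositions of functions, the rightmost factor acting first. The Coxeter element
`c = (1, 2, ..., n)` is `finRotate n`. -/

/-- `ℓ_T(π)`: the least number of factors in an expression of `π` as a product of
transpositions. -/
noncomputable def reflLength {n : ℕ} (π : Perm (Fin n)) : ℕ :=
  sInf {k | ∃ l : List (Perm (Fin n)), l.length = k ∧ (∀ t ∈ l, t.IsSwap) ∧ l.prod = π}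

theorem exists_word {n : ℕ} (π : Perm (Fin n)) :
    ∃ l : List (Perm (Fin n)), l.length = reflLength π ∧ (∀ t ∈ l, t.IsSwap) ∧ l.prod = π := by
  have h : {k | ∃ l : List (Perm (Fin n)),
      l.length = k ∧ (∀ t ∈ l, t.IsSwap) ∧ l.prod = π}.Nonempty := by
    obtain ⟨l, h1, h2⟩ := (Perm.truncSwapFactors π).out
    exact ⟨l.length, l, rfl, h2, h1⟩
  exact Nat.sInf_mem h

theorem reflLength_le {n : ℕ} (l : List (Perm (Fin n))) (h : ∀ t ∈ l, t.IsSwap) :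
    reflLength l.prod ≤ l.length :=
  Nat.sInf_le ⟨l, rfl, h, rfl⟩

theorem reflLength_one (n : ℕ) : reflLength (1 : Perm (Fin n)) = 0 := by
  have := reflLength_le (n := n) [] (by simp)
  simpa using this

theorem eq_one_of_reflLength {n : ℕ} {π : Perm (Fin n)} (h : reflLength π = 0) : π = 1 := by
  obtain ⟨l, h1, -, h3⟩ := exists_word π
  rw [h, List.length_eq_zero_iff] at h1
  simpa [h1] using h3.symm

theorem reflLength_mul_le {n : ℕ} (π σ : Perm (Fin n)) :
    reflLength (π * σ) ≤ reflLength π + reflLength σ := by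
  obtain ⟨l, h1, h2, h3⟩ := exists_word π
  obtain ⟨m, k1, k2, k3⟩ := exists_word σ
  have := reflLength_le (l ++ m) (by
    intro t ht
    rcases List.mem_append.1 ht with h | h
    · exact h2 t h
    · exact k2 t h)
  simpa [h1, h3, k1, k3] using this

theorem reflLength_swap_le {n : ℕ} {t : Perm (Fin n)} (h : t.IsSwap) : reflLength t ≤ 1 := by
  simpa using reflLength_le [t] (by simpa using h)

/-- The noncrossing partition lattice `NC(n)`. -/
def NC (n : ℕ) : Type :=
  {π : Perm (Fin n) // reflLength π + reflLength (π⁻¹ * finRotate n) = reflLength (finRotate n)}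

/-- The order of `NC(n)`: `π ≤ σ` iff `ℓ_T(π) + ℓ_T(π⁻¹ σ) = ℓ_T(σ)`. -/
instance instPartialOrderNC (n : ℕ) : PartialOrder (NC n) where
  le π σ := reflLength π.1 + reflLength (π.1⁻¹ * σ.1) = reflLength σ.1
  le_refl π := by simp [reflLength_one]
  le_trans π σ τ h1 h2 := by
    have a := reflLength_mul_le (π.1⁻¹ * σ.1) (σ.1⁻¹ * τ.1)
    have b := reflLength_mul_le π.1 (π.1⁻¹ * τ.1)
    simp only [mul_assoc, mul_inv_cancel_left] at a b
    change reflLength π.1 + reflLength (π.1⁻¹ * τ.1) = reflLength τ.1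
    change reflLength π.1 + reflLength (π.1⁻¹ * σ.1) = reflLength σ.1 at h1
    change reflLength σ.1 + reflLength (σ.1⁻¹ * τ.1) = reflLength τ.1 at h2
    omega
  le_antisymm π σ h1 h2 := by
    change reflLength π.1 + reflLength (π.1⁻¹ * σ.1) = reflLength σ.1 at h1
    change reflLength σ.1 + reflLength (σ.1⁻¹ * π.1) = reflLength π.1 at h2
    have h := eq_one_of_reflLength (π := π.1⁻¹ * σ.1) (by omega)
    exact Subtype.ext (inv_mul_eq_one.1 h)

theorem NC.le_def {n : ℕ} (π σ : NC n) :
    π ≤ σ ↔ reflLength π.1 + reflLength (π.1⁻¹ * σ.1) = reflLength σ.1 := Iff.rfl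

/-- `F_n`: the set of all maximal chains in `NC(n)`. -/
abbrev F (n : ℕ) : Type := Flag (NC n)

/-! ### Maximal chains as factorizations of the long cycle -/

/-- The list `(t_1, ..., t_{n-1})` consists of `n - 1` transpositions with product `c`. -/
def IsFactorization (n : ℕ) (l : List (Perm (Fin n))) : Prop :=
  l.length = n - 1 ∧ (∀ t ∈ l, t.IsSwap) ∧ l.prod = finRotate n

theorem le_length_of_prod_eq {n : ℕ} (l : List (Perm (Fin n))) (h : ∀ t ∈ l, t.IsSwap)
    (hl : l.prod = finRotate n) : n - 1 ≤ l.length := by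
  rcases n with _ | n
  · simp
  choose! a b hab using h
  let g : (Fin (n + 1) → ℚ) →ₗ[ℚ] (Fin l.length → ℚ) :=
    LinearMap.pi fun i =>
      (LinearMap.proj (R := ℚ) (φ := fun _ : Fin (n + 1) => ℚ) (a (l.get i)) -
        LinearMap.proj (R := ℚ) (φ := fun _ : Fin (n + 1) => ℚ) (b (l.get i)))
  have hker : LinearMap.ker g ≤ Submodule.span ℚ {(fun _ => 1 : Fin (n + 1) → ℚ)} := by
    intro v hv
    have hv' : ∀ t ∈ l, v (a t) = v (b t) := by
      intro t ht
      obtain ⟨i, rfl⟩ := List.get_of_mem ht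
      have := congrFun (LinearMap.mem_ker.1 hv) i
      simpa [g, sub_eq_zero] using this
    have hinv : ∀ m : List (Perm (Fin (n + 1))), (∀ t ∈ m, t ∈ l) → ∀ x, v (m.prod x) = v x := by
      intro m
      induction m with
      | nil => simp
      | cons t m ih =>
        intro hm x
        have ht := hm t (by simp)
        rw [List.prod_cons, Perm.mul_apply, ← ih (fun s hs => hm s (by simp [hs])) x]
        generalize m.prod x = y
        rw [(hab t ht).2, swap_apply_def]
        split_ifs with h1 h2
        · rw [h1, hv' t ht]
        · rw [h2, hv' t ht]
        · rfl
    have hc : ∀ x, v (x + 1) = v x := by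
      intro x
      have := hinv l (fun _ h => h) x
      rwa [hl, finRotate_apply] at this
    rw [Submodule.mem_span_singleton]
    refine ⟨v 0, ?_⟩
    funext x
    simp only [Pi.smul_apply, smul_eq_mul, mul_one]
    induction x using Fin.induction with
    | zero => rfl
    | succ i ih => rw [ih, ← Fin.coeSucc_eq_succ, hc]
  have h1 := g.finrank_range_add_finrank_ker
  have h2 := Submodule.finrank_mono hker
  have h3 : Module.finrank ℚ (Submodule.span ℚ {(fun _ => 1 : Fin (n + 1) → ℚ)}) ≤ 1 := by
    simpa using finrank_span_le_card (R := ℚ) ({(fun _ => 1 : Fin (n + 1) → ℚ)} : Set _)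
  have h4 := Submodule.finrank_le (LinearMap.range g)
  simp only [Module.finrank_fintype_fun_eq_card, Fintype.card_fin] at h1 h4
  omega

/-- The word `((1,2), (2,3), ..., (n-1,n))`. -/
def eWord (n : ℕ) : List (Perm (Fin n)) :=
  List.ofFn fun i : Fin (n - 1) => swap ⟨i.1, by omega⟩ ⟨i.1 + 1, by omega⟩

theorem isFactorization_eWord (n : ℕ) : IsFactorization n (eWord n) := by
  refine ⟨by simp [eWord], ?_, ?_⟩
  · intro t ht
    obtain ⟨i, rfl⟩ := (List.mem_ofFn' _ _).1 ht
    exact ⟨_, _, by simp, rfl⟩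
  · have key : ∀ d j, j + d = n - 1 → ∀ x : Fin n, (((eWord n).drop j).prod x).1 =
        if x.1 < j then x.1 else if x.1 + 1 = n then j else x.1 + 1 := by
      intro d
      induction d with
      | zero =>
        intro j hj x
        rw [List.drop_eq_nil_of_le (by simp [eWord]; omega)]
        simp only [List.prod_nil, Perm.coe_one, id]
        have := x.2
        split_ifs <;> omega
      | succ d ih =>
        intro j hj x
        have hlen : j < (eWord n).length := by simp [eWord]; omega
        rw [List.drop_eq_getElem_cons hlen, List.prod_cons, Perm.mul_apply]
        have h := ih (j + 1) (by omega) x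
        generalize ((eWord n).drop (j + 1)).prod x = y at h
        simp only [eWord, List.getElem_ofFn, swap_apply_def, Fin.ext_iff]
        have := x.2
        split_ifs at h ⊢ <;> simp_all <;> omega
    ext x
    have h := key (n - 1) 0 (by omega) x
    rw [List.drop_zero] at h
    rw [h]
    rcases n with _ | n
    · exact x.elim0
    rw [coe_finRotate]
    simp [Fin.ext_iff]

theorem reflLength_finRotate (n : ℕ) : reflLength (finRotate n) = n - 1 := by
  apply le_antisymm
  · obtain ⟨h1, h2, h3⟩ := isFactorization_eWord n
    rw [← h3, ← h1]
    exact reflLength_le _ h2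
  · obtain ⟨l, h1, h2, h3⟩ := exists_word (finRotate n)
    rw [← h1]
    exact le_length_of_prod_eq l h2 h3

theorem IsFactorization.reflLength_take {n : ℕ} {l : List (Perm (Fin n))}
    (hl : IsFactorization n l) {k : ℕ} (hk : k ≤ n - 1) : reflLength (l.take k).prod = k := by
  obtain ⟨h1, h2, h3⟩ := hl
  have a := reflLength_le (l.take k) fun t ht => h2 t (List.mem_of_mem_take ht)
  have b := reflLength_le (l.drop k) fun t ht => h2 t (List.mem_of_mem_drop ht)
  have c := reflLength_mul_le (l.take k).prod (l.drop k).prod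
  rw [← List.prod_append, List.take_append_drop, h3, reflLength_finRotate] at c
  simp only [List.length_take, List.length_drop] at a b
  omega

theorem IsFactorization.take_le {n : ℕ} {l : List (Perm (Fin n))} (hl : IsFactorization n l)
    {j k : ℕ} (hjk : j ≤ k) :
    reflLength (l.take j).prod + reflLength ((l.take j).prod⁻¹ * (l.take k).prod) =
      reflLength (l.take k).prod := by
  wlog hk : k ≤ n - 1 generalizing j k
  · have e : ∀ i, l.take i = l.take (min i (n - 1)) := by
      intro i
      conv_lhs => rw [List.take_eq_take_min, hl.1]
    rw [e j, e k]
    exact this (by omega) (by omega)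
  have e : (l.take j).prod⁻¹ * (l.take k).prod = ((l.take k).drop j).prod := by
    rw [inv_mul_eq_iff_eq_mul]
    conv_lhs => rw [← List.take_append_drop j (l.take k), List.prod_append]
    rw [List.take_take, min_eq_left hjk]
  have b := reflLength_le ((l.take k).drop j)
    fun t ht => hl.2.1 t (List.mem_of_mem_take (List.mem_of_mem_drop ht))
  have c := reflLength_mul_le (l.take j).prod ((l.take j).prod⁻¹ * (l.take k).prod)
  rw [mul_inv_cancel_left] at c
  rw [← e] at b
  rw [hl.reflLength_take hk, hl.reflLength_take (hjk.trans hk)] at *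
  have := hl.1
  simp only [List.length_take, List.length_drop] at b
  omega

theorem IsFactorization.take_mem {n : ℕ} {l : List (Perm (Fin n))} (hl : IsFactorization n l)
    (k : ℕ) : reflLength (l.take k).prod + reflLength ((l.take k).prod⁻¹ * finRotate n) =
      reflLength (finRotate n) := by
  have h := hl.take_le (j := k) (k := max k l.length) (le_max_left _ _)
  rwa [List.take_of_length_le (le_max_right _ _), hl.2.2] at h

theorem NC.eq_of_comparable {n : ℕ} {x y : NC n} (h : x ≤ y ∨ y ≤ x)
    (hr : reflLength x.1 = reflLength y.1) : x = y := by
  rcases h with h | h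
  · have h' := (NC.le_def _ _).1 h
    exact Subtype.ext (inv_mul_eq_one.1 (eq_one_of_reflLength (by omega)))
  · have h' := (NC.le_def _ _).1 h
    exact (Subtype.ext (inv_mul_eq_one.1 (eq_one_of_reflLength (by omega)))).symm

theorem NC.reflLength_le {n : ℕ} (x : NC n) : reflLength x.1 ≤ n - 1 := by
  have h := x.2
  have h' := reflLength_finRotate n
  omega

/-- The maximal chain `1 < t_1 < t_1 t_2 < ... < t_1 ⋯ t_{n-1} = c` of a factorization. -/
def ofFactorization {n : ℕ} (l : {l : List (Perm (Fin n)) // IsFactorization n l}) : F n where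
  carrier := {x | ∃ k, x.1 = (l.1.take k).prod}
  Chain' := by
    rintro x ⟨j, hj⟩ y ⟨k, hk⟩ -
    rcases le_total j k with h | h
    · left
      change x ≤ y
      rw [NC.le_def, hj, hk]
      exact l.2.take_le h
    · right
      change y ≤ x
      rw [NC.le_def, hj, hk]
      exact l.2.take_le h
  max_chain' := by
    intro s hs hsub
    refine Set.Subset.antisymm hsub fun x hx => ?_
    let y : NC n := ⟨_, l.2.take_mem (reflLength x.1)⟩
    have hy : y ∈ s := hsub ⟨_, rfl⟩
    have : x = y := NC.eq_of_comparable (hs.total hx hy) (l.2.reflLength_take x.reflLength_le).symm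
    exact ⟨reflLength x.1, congrArg Subtype.val this⟩

theorem mem_ofFactorization {n : ℕ} (l : {l : List (Perm (Fin n)) // IsFactorization n l})
    (x : NC n) : x ∈ ofFactorization l ↔ ∃ k, x.1 = (l.1.take k).prod := Iff.rfl

theorem ofFactorization_injective (n : ℕ) : Function.Injective (ofFactorization (n := n)) := by
  intro l m h
  have key : ∀ k ≤ n - 1, (l.1.take k).prod = (m.1.take k).prod := by
    intro k hk
    let y : NC n := ⟨_, l.2.take_mem k⟩
    have hy : y ∈ ofFactorization l := ⟨k, rfl⟩
    rw [h, mem_ofFactorization] at hy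
    obtain ⟨j, hj⟩ := hy
    change (l.1.take k).prod = (m.1.take j).prod at hj
    rcases le_total j (n - 1) with hjn | hjn
    · have := l.2.reflLength_take hk
      rw [hj, m.2.reflLength_take hjn] at this
      rw [hj, this]
    · have := l.2.reflLength_take hk
      have e : m.1.take j = m.1.take (n - 1) := by
        rw [List.take_of_length_le (by rw [m.2.1]; exact hjn),
          List.take_of_length_le (by rw [m.2.1])]
      rw [hj, e, m.2.reflLength_take le_rfl] at this
      rw [hj, e, this]
  apply Subtype.ext
  apply List.ext_getElem (by rw [l.2.1, m.2.1])
  intro k h1 h2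
  have hk : k + 1 ≤ n - 1 := by rw [l.2.1] at h1; exact h1
  have a := key (k + 1) hk
  rwa [List.prod_take_succ _ _ h1, List.prod_take_succ _ _ h2, key k (by omega),
    mul_left_cancel_iff] at a

theorem ofFactorization_surjective (n : ℕ) : Function.Surjective (ofFactorization (n := n)) := by
  intro C
  have memC : ∀ z : NC n, (∀ u ∈ C, u ≤ z ∨ z ≤ u) → z ∈ C := by
    intro z hz
    have hch : IsChain (· ≤ ·) (insert z C.carrier) :=
      C.Chain'.insert fun u hu _ => (hz u hu).symm
    have := C.max_chain' hch (Set.subset_insert _ _)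
    change z ∈ C.carrier
    rw [this]
    exact Set.mem_insert _ _
  have tot : ∀ u ∈ C, ∀ v ∈ C, u ≤ v ∨ v ≤ u := fun u hu v hv => C.Chain'.total hu hv
  have key : ∀ k ≤ n - 1, ∃ l : List (Perm (Fin n)), l.length = k ∧ (∀ t ∈ l, t.IsSwap) ∧
      reflLength l.prod = k ∧ ∀ j, ∃ z ∈ C, z.1 = (l.take j).prod := by
    intro k
    induction k with
    | zero =>
      intro _
      let z : NC n := ⟨1, by simp [reflLength_one]⟩
      refine ⟨[], rfl, by simp, by simp [reflLength_one], fun j => ⟨z, memC z ?_, by simp [z]⟩⟩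
      intro u _
      right
      rw [NC.le_def]
      simp [z, reflLength_one]
    | succ k ih =>
      intro hk
      obtain ⟨l, h1, h2, h3, h4⟩ := ih (by omega)
      obtain ⟨x, hxC, hx⟩ := h4 k
      rw [List.take_of_length_le h1.le] at hx
      have hcC : ∃ y ∈ C, k < reflLength y.1 := by
        let y : NC n := ⟨finRotate n, by simp [reflLength_one]⟩
        refine ⟨y, memC y fun u _ => Or.inl u.2, ?_⟩
        change k < reflLength (finRotate n)
        rw [reflLength_finRotate]
        omega
      obtain ⟨y, ⟨hyC, hky⟩, hmin⟩ := WellFounded.has_min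
        (InvImage.wf (fun y : NC n => reflLength y.1) Nat.lt_wfRel.wf)
        {y | y ∈ C ∧ k < reflLength y.1} hcC
      have hxy : reflLength x.1 + reflLength (x.1⁻¹ * y.1) = reflLength y.1 := by
        rcases tot x hxC y hyC with h | h
        · exact h
        · have := (NC.le_def _ _).1 h
          rw [hx, h3] at this
          omega
      obtain ⟨w, w1, w2, w3⟩ := exists_word (x.1⁻¹ * y.1)
      rcases w with _ | ⟨t, w⟩
      · rw [hx, h3, ← hx] at hxy
        simp at w1
        omega
      have hy : y.1 = x.1 * t * w.prod := by
        rw [mul_assoc, ← List.prod_cons, w3, mul_inv_cancel_left]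
      have ht : t.IsSwap := w2 t (by simp)
      have hxl : reflLength x.1 = k := by rw [hx, h3]
      have a1 := reflLength_mul_le x.1 t
      have a2 := reflLength_swap_le ht
      have a3 := reflLength_mul_le (x.1 * t) w.prod
      have a4 := reflLength_le w fun s hs => w2 s (by simp [hs])
      rw [← hy] at a3
      simp only [List.length_cons] at w1
      have hz : reflLength (x.1 * t) = k + 1 := by omega
      have hzw : reflLength w.prod = w.length := by omega
      have hzc : reflLength (x.1 * t) + reflLength ((x.1 * t)⁻¹ * finRotate n) =
          reflLength (finRotate n) := by
        have b1 := reflLength_mul_le (x.1 * t) ((x.1 * t)⁻¹ * finRotate n)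
        rw [mul_inv_cancel_left] at b1
        have b2 := reflLength_mul_le ((x.1 * t)⁻¹ * y.1) (y.1⁻¹ * finRotate n)
        have b3 := y.2
        rw [mul_assoc, mul_inv_cancel_left] at b2
        have b4 : (x.1 * t)⁻¹ * y.1 = w.prod := by rw [hy]; group
        rw [b4] at b2
        omega
      let z : NC n := ⟨x.1 * t, hzc⟩
      have hxz : x ≤ z := by
        have e : x.1⁻¹ * (x.1 * t) = t := by group
        have b := reflLength_mul_le x.1 t
        rw [NC.le_def]
        change reflLength x.1 + reflLength (x.1⁻¹ * (x.1 * t)) = reflLength (x.1 * t)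
        rw [e]
        omega
      have hzy : z ≤ y := by
        have e : (x.1 * t)⁻¹ * y.1 = w.prod := by rw [hy]; group
        rw [NC.le_def]
        change reflLength (x.1 * t) + reflLength ((x.1 * t)⁻¹ * y.1) = reflLength y.1
        rw [e]
        omega
      have hzC : z ∈ C := by
        apply memC
        intro u hu
        rcases le_or_gt (reflLength u.1) k with h | h
        · left
          refine le_trans ?_ hxz
          rcases tot u hu x hxC with h' | h'
          · exact h'
          · have := (NC.le_def _ _).1 h'
            exact (NC.eq_of_comparable (Or.inl h') (by omega)).ge
        · right
          refine le_trans hzy ?_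
          have hm : ¬ reflLength u.1 < reflLength y.1 := hmin u ⟨hu, h⟩
          rcases tot u hu y hyC with h' | h'
          · have := (NC.le_def _ _).1 h'
            exact (NC.eq_of_comparable (Or.inl h') (by omega)).ge
          · exact h'
      refine ⟨l ++ [t], by simp [h1], ?_, ?_, ?_⟩
      · intro s hs
        rcases List.mem_append.1 hs with h | h
        · exact h2 s h
        · rw [List.mem_singleton.1 h]
          exact ht
      · rw [List.prod_append, List.prod_singleton, ← hx]
        exact hz
      · intro j
        rcases le_or_gt j k with h | h
        · rw [List.take_append_of_le_length (by omega)]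
          exact h4 j
        · refine ⟨z, hzC, ?_⟩
          rw [List.take_of_length_le (by simp; omega), List.prod_append, List.prod_singleton, ← hx]
  obtain ⟨l, h1, h2, h3, h4⟩ := key (n - 1) le_rfl
  have hprod : l.prod = finRotate n := by
    obtain ⟨z, -, hz⟩ := h4 (n - 1)
    rw [List.take_of_length_le h1.le] at hz
    have := z.2
    rw [hz, h3, reflLength_finRotate] at this
    exact inv_mul_eq_one.1 (eq_one_of_reflLength (by omega))
  refine ⟨⟨l, h1, h2, hprod⟩, ?_⟩
  apply Flag.ext
  apply (ofFactorization ⟨l, h1, h2, hprod⟩).max_chain' C.Chain'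
  rintro x ⟨k, hk⟩
  obtain ⟨z, hz, hzk⟩ := h4 k
  have : x = z := Subtype.ext (hk.trans hzk.symm)
  rw [this]
  exact hz

/-- Maximal chains of `NC(n)` correspond to factorizations `t_1 ⋯ t_{n-1} = c`. -/
noncomputable def factorizationEquiv (n : ℕ) :
    {l : List (Perm (Fin n)) // IsFactorization n l} ≃ F n :=
  Equiv.ofBijective ofFactorization ⟨ofFactorization_injective n, ofFactorization_surjective n⟩

/-- The list `(t_1, ..., t_{n-1})` of a maximal chain. -/
noncomputable def word {n : ℕ} (w : F n) : List (Perm (Fin n)) :=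
  ((factorizationEquiv n).symm w).1

theorem word_spec {n : ℕ} (w : F n) : IsFactorization n (word w) :=
  ((factorizationEquiv n).symm w).2

/-- The maximal chain with a given list `(t_1, ..., t_{n-1})`. -/
noncomputable def ofWord {n : ℕ} (l : List (Perm (Fin n))) (hl : IsFactorization n l) : F n :=
  factorizationEquiv n ⟨l, hl⟩

theorem word_ofWord {n : ℕ} (l : List (Perm (Fin n))) (hl : IsFactorization n l) :
    word (ofWord l hl) = l := by
  simp [word, ofWord]

theorem ofWord_word {n : ℕ} (w : F n) : ofWord (word w) (word_spec w) = w := by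
  simp [word, ofWord]

theorem mem_iff_word {n : ℕ} (w : F n) (x : NC n) :
    x ∈ w ↔ ∃ k, x.1 = ((word w).take k).prod := by
  conv_lhs => rw [← ofWord_word w]
  exact Iff.rfl

/-! ### The Hurwitz graph and the weak order -/

/-- The Hurwitz graph `G_T(n)`: two maximal chains are adjacent if they differ in exactly one
element. -/
def hurwitzGraph (n : ℕ) : SimpleGraph (F n) where
  Adj u v := ((u : Set (NC n)) \ v).ncard = 1 ∧ ((v : Set (NC n)) \ u).ncard = 1
  symm := ⟨fun _ _ h => ⟨h.2, h.1⟩⟩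
  loopless := ⟨fun u h => by simp at h⟩

/-- The maximal chain `e = ((1,2), (2,3), ..., (n-1,n))`. -/
noncomputable def e (n : ℕ) : F n := ofWord (eWord n) (isFactorization_eWord n)

/-- The weak order on `F_n`: `u ≤ v` iff `u` belongs to a geodesic (a walk of minimal length)
in `G_T(n)` from `e` to `v`. -/
def weakLE {n : ℕ} (u v : F n) : Prop :=
  ∃ p : (hurwitzGraph n).Walk (e n) v, p.length = (hurwitzGraph n).dist (e n) v ∧ u ∈ p.support

/-- The strict weak order. -/
def weakLT {n : ℕ} (u v : F n) : Prop := weakLE u v ∧ u ≠ v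

/-- The lower interval `[e, w]` of the weak order. -/
def lowerInterval {n : ℕ} (w : F n) : Set (F n) := {v | weakLE (e n) v ∧ weakLE v w}

/-! ### The operators `R_i` and `L_i`

Positions are counted from `0`: `R i`, `L i`, `down i` are `R_{i+1}`, `L_{i+1}`, `D_{i+1}` in the
usual numbering, and they are meant for `i < n - 2`. -/

/-- Replace `(t_i, t_{i+1})` by `(t_i⁻¹ t_{i+1} t_i, t_i)` in a list. -/
def slideR {G : Type*} [Group G] : ℕ → List G → List G
  | 0, s :: t :: l => (s⁻¹ * t * s) :: s :: l
  | i + 1, s :: l => s :: slideR i l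
  | _, l => l

/-- Replace `(t_i, t_{i+1})` by `(t_{i+1}, t_{i+1}⁻¹ t_i t_{i+1})` in a list. -/
def slideL {G : Type*} [Group G] : ℕ → List G → List G
  | 0, s :: t :: l => t :: (t⁻¹ * s * t) :: l
  | i + 1, s :: l => s :: slideL i l
  | _, l => l

theorem isSwap_conj {n : ℕ} {s t : Perm (Fin n)} (ht : t.IsSwap) : (s⁻¹ * t * s).IsSwap := by
  obtain ⟨x, y, hxy, rfl⟩ := ht
  refine ⟨s⁻¹ x, s⁻¹ y, by simpa using hxy, ?_⟩
  rw [swap_apply_apply]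
  simp

theorem slideR_spec {n : ℕ} (i : ℕ) (l : List (Perm (Fin n))) (hl : ∀ t ∈ l, t.IsSwap) :
    (slideR i l).length = l.length ∧ (∀ t ∈ slideR i l, t.IsSwap) ∧
      (slideR i l).prod = l.prod := by
  induction i, l using slideR.induct with
  | case1 s t l =>
    simp only [List.mem_cons, forall_eq_or_imp] at hl
    obtain ⟨hs, ht, hl⟩ := hl
    refine ⟨by simp [slideR], ?_, ?_⟩
    · simp only [slideR, List.mem_cons, forall_eq_or_imp]
      exact ⟨isSwap_conj ht, hs, hl⟩
    · have h2 : s⁻¹ = s := by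
        obtain ⟨x, y, -, rfl⟩ := hs
        exact swap_inv x y
      have h3 : s * s = 1 := by
        nth_rewrite 1 [← h2]
        exact inv_mul_cancel s
      simp only [slideR, List.prod_cons, h2, mul_assoc]
      rw [← mul_assoc s s, h3, one_mul]
  | case2 i s l ih =>
    simp only [List.mem_cons, forall_eq_or_imp] at hl
    obtain ⟨h1, h2, h3⟩ := ih hl.2
    refine ⟨by simp [slideR, h1], ?_, by simp [slideR, h3]⟩
    simp only [slideR, List.mem_cons, forall_eq_or_imp]
    exact ⟨hl.1, h2⟩
  | case3 i l h1 h2 =>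
    have : slideR i l = l := by rw [slideR]; exacts [h1, h2]
    rw [this]
    exact ⟨rfl, hl, rfl⟩

theorem slideL_spec {n : ℕ} (i : ℕ) (l : List (Perm (Fin n))) (hl : ∀ t ∈ l, t.IsSwap) :
    (slideL i l).length = l.length ∧ (∀ t ∈ slideL i l, t.IsSwap) ∧
      (slideL i l).prod = l.prod := by
  induction i, l using slideL.induct with
  | case1 s t l =>
    simp only [List.mem_cons, forall_eq_or_imp] at hl
    obtain ⟨hs, ht, hl⟩ := hl
    refine ⟨by simp [slideL], ?_, ?_⟩
    · simp only [slideL, List.mem_cons, forall_eq_or_imp]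
      exact ⟨ht, isSwap_conj hs, hl⟩
    · simp [slideL, mul_assoc]
  | case2 i s l ih =>
    simp only [List.mem_cons, forall_eq_or_imp] at hl
    obtain ⟨h1, h2, h3⟩ := ih hl.2
    refine ⟨by simp [slideL, h1], ?_, by simp [slideL, h3]⟩
    simp only [slideL, List.mem_cons, forall_eq_or_imp]
    exact ⟨hl.1, h2⟩
  | case3 i l h1 h2 =>
    have : slideL i l = l := by rw [slideL]; exacts [h1, h2]
    rw [this]
    exact ⟨rfl, hl, rfl⟩

theorem IsFactorization.slideR {n : ℕ} {l : List (Perm (Fin n))} (hl : IsFactorization n l)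
    (i : ℕ) : IsFactorization n (slideR i l) := by
  obtain ⟨h1, h2, h3⟩ := slideR_spec i l hl.2.1
  exact ⟨h1.trans hl.1, h2, h3.trans hl.2.2⟩

theorem IsFactorization.slideL {n : ℕ} {l : List (Perm (Fin n))} (hl : IsFactorization n l)
    (i : ℕ) : IsFactorization n (slideL i l) := by
  obtain ⟨h1, h2, h3⟩ := slideL_spec i l hl.2.1
  exact ⟨h1.trans hl.1, h2, h3.trans hl.2.2⟩

/-- `R_i(t_1, ..., t_{n-1}) = (..., t_i⁻¹ t_{i+1} t_i, t_i, ...)`. -/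
noncomputable def R {n : ℕ} (i : ℕ) (w : F n) : F n :=
  ofWord (slideR i (word w)) ((word_spec w).slideR i)

/-- `L_i(t_1, ..., t_{n-1}) = (..., t_{i+1}, t_{i+1}⁻¹ t_i t_{i+1}, ...)`. -/
noncomputable def L {n : ℕ} (i : ℕ) (w : F n) : F n :=
  ofWord (slideL i (word w)) ((word_spec w).slideL i)

/-! ### The map `φ : F_n → S_{n-1}` -/

/-- The partial product `t_j t_{j+1} ⋯ t_{n-1}` (with `j` counted from `0`). -/
noncomputable def sigma {n : ℕ} (w : F n) (j : ℕ) : Perm (Fin n) := ((word w).drop j).prod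

/-- `A_j = {1 ≤ i ≤ n - 1 : σ_j(i) > σ_{j+1}(i)}`. -/
def A {n : ℕ} (w : F n) (j : Fin (n - 1)) : Set (Fin (n - 1)) :=
  {i | sigma w (j + 1) (i.castLE (Nat.sub_le n 1)) < sigma w j (i.castLE (Nat.sub_le n 1))}

theorem A_subsingleton {n : ℕ} (w : F n) (j : Fin (n - 1)) : (A w j).Subsingleton := by
  have hlen : j.1 < (word w).length := by rw [(word_spec w).1]; exact j.2
  obtain ⟨x, y, hxy, ht⟩ := (word_spec w).2.1 _ (List.getElem_mem hlen)
  have hs : sigma w j = swap x y * sigma w (j + 1) := by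
    rw [sigma, List.drop_eq_getElem_cons hlen, List.prod_cons, ht]
    rfl
  have key : ∀ i ∈ A w j, sigma w (j + 1) (i.castLE (Nat.sub_le n 1)) = min x y := by
    intro i hi
    simp only [A, Set.mem_ofPred_eq, hs, Perm.mul_apply] at hi
    generalize sigma w (j + 1) (i.castLE (Nat.sub_le n 1)) = z at *
    rw [swap_apply_def] at hi
    split_ifs at hi with h1 h2
    · rw [h1, min_eq_left (h1 ▸ hi).le]
    · rw [h2, min_eq_right (h2 ▸ hi).le]
    · exact absurd hi (lt_irrefl _)
  intro i hi i' hi'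
  exact Fin.castLE_injective _
    ((sigma w (j + 1)).injective ((key i hi).trans (key i' hi').symm))

theorem exists_mem_A {n : ℕ} (w : F n) (i : Fin (n - 1)) : ∃ j, i ∈ A w j := by
  by_contra! h
  have key : ∀ j ≤ n - 1,
      sigma w 0 (i.castLE (Nat.sub_le n 1)) ≤ sigma w j (i.castLE (Nat.sub_le n 1)) := by
    intro j
    induction j with
    | zero => exact fun _ => le_rfl
    | succ j ih =>
      intro hj
      refine (ih (by omega)).trans ?_
      have := h ⟨j, hj⟩
      simpa [A] using this
  have h1 := key (n - 1) le_rfl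
  have h2 : sigma w (n - 1) = 1 := by
    rw [sigma, List.drop_eq_nil_of_le (by rw [(word_spec w).1]), List.prod_nil]
  have h3 : sigma w 0 = finRotate n := by
    rw [sigma, List.drop_zero, (word_spec w).2.2]
  rw [h2, h3] at h1
  rcases n with _ | n
  · exact i.elim0
  · have hi := i.2
    rw [Fin.le_def, finRotate_of_lt (by simp)] at h1
    simp at h1

theorem index_bijective {n : ℕ} (w : F n) :
    Function.Bijective fun i => (exists_mem_A w i).choose := by
  rw [← Finite.injective_iff_bijective]
  intro i i' h
  have h1 := (exists_mem_A w i).choose_spec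
  have h2 := (exists_mem_A w i').choose_spec
  simp only at h
  rw [← h] at h2
  exact A_subsingleton w _ h1 h2

/-- `φ(w)` is the permutation `π_w` of `1, ..., n - 1` with `π_w(j) = i` if `A_j = {i}`; see
`A_eq_singleton`. -/
noncomputable def phi {n : ℕ} (w : F n) : Perm (Fin (n - 1)) :=
  (Equiv.ofBijective _ (index_bijective w)).symm

theorem A_eq_singleton {n : ℕ} (w : F n) (j : Fin (n - 1)) : A w j = {phi w j} := by
  have h : phi w j ∈ A w j := by
    have h1 := (exists_mem_A w (phi w j)).choose_spec
    have h2 : (exists_mem_A w (phi w j)).choose = j :=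
      (Equiv.ofBijective _ (index_bijective w)).apply_symm_apply j
    rwa [h2] at h1
  exact (A_subsingleton w j).eq_singleton_of_mem h

/-- `i` belongs to the descent set `{i : π(i) > π(i+1)}` (with `i` counted from `0`). -/
def IsDescent {m : ℕ} (π : Perm (Fin m)) (i : ℕ) : Prop :=
  ∃ h : i + 1 < m, π ⟨i + 1, h⟩ < π ⟨i, by omega⟩

/-! ### Down operators and the `0`-Hecke algebra -/

open Classical in
/-- The down operator `D_i`: it is `R_i(w)` if `i` is a descent of `φ(w)` and `R_i(w) < w`, it is
`L_i(w)` if `i` is a descent of `φ(w)` and `L_i(w) < w`, and it is `w` if `i` is not a descent. -/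
noncomputable def down {n : ℕ} (i : ℕ) (w : F n) : F n :=
  if IsDescent (phi w) i then
    if weakLT (R i w) w then R i w
    else if weakLT (L i w) w then L i w
    else w
  else w

/-- The defining relations of the `0`-Hecke algebra `H_m(0)`, on generators
`T_1, ..., T_{m-1}` (counted from `0`). -/
inductive HeckeRel (m : ℕ) :
    FreeAlgebra ℚ (Fin (m - 1)) → FreeAlgebra ℚ (Fin (m - 1)) → Prop
  | idem (i : Fin (m - 1)) :
      HeckeRel m (FreeAlgebra.ι ℚ i * FreeAlgebra.ι ℚ i) (FreeAlgebra.ι ℚ i)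
  | comm (i j : Fin (m - 1)) (h : i.1 + 1 < j.1 ∨ j.1 + 1 < i.1) :
      HeckeRel m (FreeAlgebra.ι ℚ i * FreeAlgebra.ι ℚ j) (FreeAlgebra.ι ℚ j * FreeAlgebra.ι ℚ i)
  | braid (i j : Fin (m - 1)) (h : j.1 = i.1 + 1) :
      HeckeRel m (FreeAlgebra.ι ℚ i * FreeAlgebra.ι ℚ j * FreeAlgebra.ι ℚ i)
        (FreeAlgebra.ι ℚ j * FreeAlgebra.ι ℚ i * FreeAlgebra.ι ℚ j)

/-- The `0`-Hecke algebra `H_m(0)` over `ℚ`. -/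
abbrev Hecke0 (m : ℕ) : Type := RingQuot (HeckeRel m)

/-- The generator `T_i` of `H_m(0)`. -/
noncomputable def Hecke0.T {m : ℕ} (i : Fin (m - 1)) : Hecke0 m :=
  RingQuot.mkAlgHom ℚ (HeckeRel m) (FreeAlgebra.ι ℚ i)

end NoncrossingChains

open NoncrossingChains

namespace NoncrossingChains

/-! ### Inversions -/

/-! The key is to follow a letter `x` through the permutations `σ_j`. By definition of `φ`, passing
from `σ_{j+1}` to `σ_j` raises the image of `x` only at the position `j` of the label `x`; every
other step fixes or lowers it. Since `σ_n(x) = x` and `σ_1(x) = x + 1`, the image exceeds `x`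
exactly at the levels up to that position (`lt_sigma_iff`). So labels can be read off from the
`σ_j`, with two consequences.

Changing a single element of a chain leaves `φ` unchanged or exchanges two neighbouring labels
(`AgreeOff.phi_eq`), and one of the two Hurwitz moves does exchange them (`phi_R_or_phi_L`).
Moreover, a stretch of a chain with increasing labels is determined by its two ends
(`sigma_eq_of_ascending`), as for EL-labelings.

Hence the number of inversions of `φ(w)` is the distance from `e` to `w` (`dist_e`), and the weak
order becomes an additivity condition on distances (`weakLE_iff`). The chain `D_i(w)` is the unique
one that agrees with `w` away from one rank and has no descent at `i` (`AgreeOff.eq_down`), so on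
labels `D_i` sorts two neighbours. Each Hecke relation compares two chains with the same ends whose
labels are sorted in between, and uniqueness makes them equal.

For faithfulness, the relations alone give a spanning set of at most `(n-1)!` normal forms
(`Hecke0.finrank_le`). Acting on a chain whose label permutation is the longest element and then
applying `φ` maps the algebra onto the space with basis `S_{n-1}`, of dimension `(n-1)!`. This
surjection is therefore injective, and so is the action. -/

/-- The number of inversions of a permutation. -/
def inv {m : ℕ} (π : Perm (Fin m)) : ℕ :=
  (Finset.univ.filter fun p : Fin m × Fin m => p.1 < p.2 ∧ π p.2 < π p.1).card

/-- The adjacent transposition of the positions `i` and `i + 1`. -/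
def adjSwap {m : ℕ} (i : ℕ) (h : i + 1 < m) : Perm (Fin m) := swap ⟨i, by omega⟩ ⟨i + 1, h⟩

theorem adjSwap_mul_self {m i : ℕ} (h : i + 1 < m) : adjSwap i h * adjSwap i h = 1 :=
  swap_mul_self _ _

theorem adjSwap_adjSwap {m i : ℕ} (h : i + 1 < m) (a : Fin m) :
    adjSwap i h (adjSwap i h a) = a :=
  swap_apply_self _ _ _

theorem adjSwap_lt {m i : ℕ} (h : i + 1 < m) {a b : Fin m} (hab : a < b)
    (hne : ¬ (a.1 = i ∧ b.1 = i + 1)) : adjSwap i h a < adjSwap i h b := by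
  simp only [adjSwap, swap_apply_def, Fin.lt_def, Fin.ext_iff] at *
  split_ifs <;> simp_all <;> omega

theorem isDescent_mul_adjSwap {m i : ℕ} (h : i + 1 < m) (π : Perm (Fin m)) :
    IsDescent (π * adjSwap i h) i ↔ ¬ IsDescent π i := by
  have hne : π ⟨i, by omega⟩ ≠ π ⟨i + 1, h⟩ := by simp
  simp only [IsDescent, h, exists_true_left, Perm.mul_apply, adjSwap, swap_apply_left,
    swap_apply_right, not_lt]
  exact ⟨le_of_lt, fun h' => lt_of_le_of_ne h' hne⟩

/-- Applying the adjacent transposition to both positions matches the inversions of the product with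
those of `π` other than the pair `(i, i + 1)`, the only pair whose order it reverses. -/
theorem inv_mul_adjSwap {m i : ℕ} (h : i + 1 < m) {π : Perm (Fin m)} (hd : IsDescent π i) :
    inv (π * adjSwap i h) + 1 = inv π := by
  have hmem : ((⟨i, by omega⟩, ⟨i + 1, h⟩) : Fin m × Fin m) ∈
      Finset.univ.filter fun p : Fin m × Fin m => p.1 < p.2 ∧ π p.2 < π p.1 := by
    simpa using hd.2
  rw [inv, inv, ← Finset.card_erase_add_one hmem, add_left_inj]
  refine Finset.card_bij' (fun p _ => (adjSwap i h p.1, adjSwap i h p.2))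
    (fun p _ => (adjSwap i h p.1, adjSwap i h p.2)) ?_ ?_ ?_ ?_
  · rintro ⟨a, b⟩ hp
    rw [Finset.mem_filter] at hp
    rw [Finset.mem_erase, Finset.mem_filter]
    obtain ⟨-, hp1, hp2⟩ := hp
    simp only [Perm.mul_apply] at hp1 hp2
    have hne : ¬ (a.1 = i ∧ b.1 = i + 1) := by
      rintro ⟨h1, h2⟩
      have h3 : adjSwap i h a = ⟨i + 1, h⟩ := by
        simp [adjSwap, show a = ⟨i, by omega⟩ from Fin.ext h1]
      have h4 : adjSwap i h b = ⟨i, by omega⟩ := by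
        simp [adjSwap, show b = ⟨i + 1, h⟩ from Fin.ext h2]
      rw [h3, h4] at hp2
      exact lt_asymm hp2 hd.2
    refine ⟨?_, Finset.mem_univ _, adjSwap_lt h hp1 hne, hp2⟩
    rintro h0
    rw [Prod.mk.injEq] at h0
    have h3 := congrArg (adjSwap i h) h0.1
    have h4 := congrArg (adjSwap i h) h0.2
    rw [adjSwap_adjSwap] at h3 h4
    simp only [adjSwap, swap_apply_left, swap_apply_right] at h3 h4
    simp [h3, h4, Fin.lt_def] at hp1
  · rintro ⟨a, b⟩ hp
    rw [Finset.mem_erase, Finset.mem_filter] at hp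
    rw [Finset.mem_filter]
    obtain ⟨hp0, -, hp1, hp2⟩ := hp
    simp only [Perm.mul_apply, adjSwap_adjSwap]
    refine ⟨Finset.mem_univ _, adjSwap_lt h hp1 ?_, hp2⟩
    rintro ⟨h1, h2⟩
    exact hp0 (Prod.ext (Fin.ext h1) (Fin.ext h2))
  · simp [adjSwap_adjSwap]
  · simp [adjSwap_adjSwap]

theorem inv_mul_adjSwap_of_not {m i : ℕ} (h : i + 1 < m) {π : Perm (Fin m)}
    (hd : ¬ IsDescent π i) : inv (π * adjSwap i h) = inv π + 1 := by
  have := inv_mul_adjSwap h ((isDescent_mul_adjSwap h π).2 hd)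
  rw [mul_assoc, adjSwap_mul_self, mul_one] at this
  exact this.symm

theorem inv_one (m : ℕ) : inv (1 : Perm (Fin m)) = 0 := by
  rw [inv, Finset.card_eq_zero, Finset.filter_eq_empty_iff]
  rintro p - ⟨h1, h2⟩
  exact lt_asymm h1 h2

theorem inv_le {m : ℕ} (π : Perm (Fin m)) : inv π ≤ m * m := by
  refine (Finset.card_filter_le _ _).trans ?_
  simp

theorem strictMono_of_not_isDescent {m : ℕ} {π : Perm (Fin m)} (h : ∀ i, ¬ IsDescent π i) :
    StrictMono π := by
  rcases m with _ | m
  · exact fun a => a.elim0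
  · refine Fin.strictMono_iff_lt_succ.2 fun i => ?_
    have h1 := h i.1
    simp only [IsDescent, not_exists, not_lt] at h1
    exact lt_of_le_of_ne (h1 (by simp))
      fun h2 => (Fin.castSucc_lt_succ (i := i)).ne (π.injective h2)

theorem eq_one_of_strictMono {m : ℕ} {π : Perm (Fin m)} (h : StrictMono π) : π = 1 := by
  have : h.orderIsoOfSurjective _ π.surjective = OrderIso.refl _ := Subsingleton.elim _ _
  ext x
  exact congrArg Fin.val (DFunLike.congr_fun this x)

theorem exists_isDescent {m : ℕ} {π : Perm (Fin m)} (h : π ≠ 1) : ∃ i, IsDescent π i := by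
  by_contra! h'
  exact h (eq_one_of_strictMono (strictMono_of_not_isDescent h'))

theorem exists_not_isDescent {m : ℕ} {π : Perm (Fin m)} (h : π ≠ Fin.revPerm) :
    ∃ i, i + 1 < m ∧ ¬ IsDescent π i := by
  -- Reversing the values turns descents into ascents, which reduces the claim to
  -- `exists_isDescent`.
  have h1 : Fin.revPerm * π ≠ 1 := by
    intro h1
    apply h
    rw [eq_inv_of_mul_eq_one_right h1]
    rfl
  obtain ⟨i, hi, h2⟩ := exists_isDescent h1
  refine ⟨i, hi, fun h3 => lt_asymm h3.2 ?_⟩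
  simpa using h2

/-! ### The permutations `σ_j` and the map `φ` -/

/-- The inclusion of the letters `1, ..., n - 1`. -/
abbrev hat {n : ℕ} (x : Fin (n - 1)) : Fin n := x.castLE (Nat.sub_le n 1)

theorem sigma_zero {n : ℕ} (w : F n) : sigma w 0 = finRotate n := by
  rw [sigma, List.drop_zero, (word_spec w).2.2]

theorem sigma_of_le {n : ℕ} (w : F n) {j : ℕ} (h : n - 1 ≤ j) : sigma w j = 1 := by
  rw [sigma, List.drop_eq_nil_of_le (by rw [(word_spec w).1]; exact h), List.prod_nil]

theorem sigma_eq_getElem_mul {n : ℕ} (w : F n) {j : ℕ} (h : j < (word w).length) :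
    sigma w j = (word w)[j] * sigma w (j + 1) := by
  rw [sigma, List.drop_eq_getElem_cons h, List.prod_cons]
  rfl

theorem take_prod_mul_sigma {n : ℕ} (w : F n) (j : ℕ) :
    ((word w).take j).prod * sigma w j = finRotate n := by
  rw [sigma, ← List.prod_append, List.take_append_drop, (word_spec w).2.2]

theorem eq_of_sigma {n : ℕ} {u v : F n} (h : ∀ j, sigma u j = sigma v j) : u = v := by
  have hw : word u = word v := by
    apply List.ext_getElem (by rw [(word_spec u).1, (word_spec v).1])
    intro k h1 h2
    have h3 := sigma_eq_getElem_mul u h1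
    rwa [h k, h (k + 1), sigma_eq_getElem_mul v h2, mul_left_inj, eq_comm] at h3
  rw [← ofWord_word u, ← ofWord_word v]
  congr 1

theorem sigma_lt_iff {n : ℕ} (w : F n) (j x : Fin (n - 1)) :
    sigma w (j + 1) (hat x) < sigma w j (hat x) ↔ x = phi w j := by
  have := A_eq_singleton w j
  rw [Set.ext_iff] at this
  exact this x

theorem sigma_phi_lt {n : ℕ} (w : F n) (j : Fin (n - 1)) :
    sigma w (j + 1) (hat (phi w j)) < sigma w j (hat (phi w j)) :=
  (sigma_lt_iff w j _).2 rfl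

theorem sigma_le_sigma_succ {n : ℕ} (w : F n) (x : Fin (n - 1)) {j : ℕ}
    (h : ((phi w)⁻¹ x).1 ≠ j) : sigma w j (hat x) ≤ sigma w (j + 1) (hat x) := by
  rcases lt_or_ge j (n - 1) with hj | hj
  · by_contra! h1
    have := (sigma_lt_iff w ⟨j, hj⟩ x).1 h1
    apply h
    rw [this]
    simp
  · rw [sigma_of_le w hj, sigma_of_le w (by omega)]

/-- As the level grows, the image of `x` drops only at the position of the label `x`. It starts at
`x + 1` and ends at `x`, so it is above `x` up to that position and at most `x` afterwards. Label
positions are recovered from the `σ_l` through this criterion throughout. -/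
theorem lt_sigma_iff {n : ℕ} (w : F n) (x : Fin (n - 1)) (l : ℕ) :
    hat x < sigma w l (hat x) ↔ l ≤ ((phi w)⁻¹ x).1 := by
  constructor
  · contrapose!
    intro h
    have key : ∀ d, sigma w l (hat x) ≤ sigma w (l + d) (hat x) := by
      intro d
      induction d with
      | zero => exact le_rfl
      | succ d ih => exact ih.trans (sigma_le_sigma_succ w x (by omega))
    have := key (n - 1)
    rwa [sigma_of_le w (j := l + (n - 1)) (by omega)] at this
  · intro h
    have key : ∀ d ≤ l, sigma w 0 (hat x) ≤ sigma w d (hat x) := by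
      intro d
      induction d with
      | zero => exact fun _ => le_rfl
      | succ d ih => exact fun hd => (ih (by omega)).trans (sigma_le_sigma_succ w x (by omega))
    refine lt_of_lt_of_le ?_ (key l le_rfl)
    rw [sigma_zero]
    rcases n with _ | n
    · exact x.elim0
    · have hx := x.2
      rw [Fin.lt_def, finRotate_of_lt (by simp)]
      simp

theorem lt_sigma_phi {n : ℕ} (w : F n) (j : Fin (n - 1)) {l : ℕ} (h : l ≤ j) :
    hat (phi w j) < sigma w l (hat (phi w j)) := by
  rw [lt_sigma_iff]
  simpa using h

theorem sigma_phi_le {n : ℕ} (w : F n) (j : Fin (n - 1)) {l : ℕ} (h : j < l) :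
    sigma w l (hat (phi w j)) ≤ hat (phi w j) := by
  rw [← not_lt, lt_sigma_iff]
  simpa using h

theorem sigma_eq_swap_mul {n : ℕ} (w : F n) (j : Fin (n - 1)) :
    sigma w j = swap (sigma w (j + 1) (hat (phi w j))) (sigma w j (hat (phi w j))) *
      sigma w (j + 1) := by
  have hlen : j.1 < (word w).length := by rw [(word_spec w).1]; exact j.2
  obtain ⟨x, y, hxy, ht⟩ := (word_spec w).2.1 _ (List.getElem_mem hlen)
  have hs := sigma_eq_getElem_mul w hlen
  have hlt := sigma_phi_lt w j
  rw [ht] at hs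
  rw [hs, Perm.mul_apply] at hlt ⊢
  rw [mul_left_inj]
  generalize sigma w (j + 1) (hat (phi w j)) = z at *
  rw [swap_apply_def] at hlt ⊢
  split_ifs at hlt ⊢ with h1 h2
  · rw [h1]
  · rw [h2, swap_comm]
  · exact absurd hlt (lt_irrefl _)

/-- A label that is followed by a smaller one is not moved by the latter. -/
theorem sigma_phi_eq_of_lt {n : ℕ} (w : F n) {l j : Fin (n - 1)} (hlj : l < j)
    (h : phi w l < phi w j) :
    sigma w l (hat (phi w j)) = sigma w (l + 1) (hat (phi w j)) := by
  have h1 := lt_sigma_phi w j (l := l) (Fin.le_def.1 hlj.le)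
  have h2 := sigma_phi_le w l (l := l + 1) (Nat.lt_succ_self _)
  -- The factor at `l` exchanges a value at most `φ(w)(l)` with a larger one. The image of the
  -- bigger label exceeds that label both before and after, so it is neither of the two values.
  have h3 := lt_sigma_phi w j (l := l + 1) (Fin.lt_def.1 hlj)
  have h4 : hat (phi w l) < hat (phi w j) := h
  have e := sigma_eq_swap_mul w l
  rw [e, Perm.mul_apply] at h1 ⊢
  apply swap_apply_of_ne_of_ne
  · intro h5
    rw [h5] at h3
    exact lt_asymm (h3.trans_le h2) h4
  · intro h5
    rw [h5, swap_apply_right] at h1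
    exact lt_asymm (h1.trans_le h2) h4

/-! ### Uniqueness of ascending stretches -/

/-- The labels `φ(w)(k)`, `a ≤ k < b`, increase. -/
def Ascending {n : ℕ} (w : F n) (a b : ℕ) : Prop :=
  ∀ k l : Fin (n - 1), a ≤ k → k < l → l < b → phi w k < phi w l

theorem Ascending.sigma_eq {n : ℕ} {w : F n} {a b : ℕ} (hw : Ascending w a b) (j : Fin (n - 1))
    (ha : a ≤ j) (hb : j < b) : sigma w a (hat (phi w j)) = sigma w j (hat (phi w j)) := by
  have key : ∀ d, a + d ≤ j → sigma w a (hat (phi w j)) = sigma w (a + d) (hat (phi w j)) := by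
    intro d
    induction d with
    | zero => exact fun _ => rfl
    | succ d ih =>
      intro hd
      have hj := j.2
      rw [ih (by omega)]
      exact sigma_phi_eq_of_lt w (l := ⟨a + d, by omega⟩) (Fin.lt_def.2 hd)
        (hw _ _ (by simp) (Fin.lt_def.2 hd) hb)
  have := key (j - a) (by omega)
  rwa [Nat.add_sub_cancel' ha] at this

/-- There is at most one ascending chain between two elements. -/
theorem sigma_eq_of_ascending {n : ℕ} {u v : F n} {a b : ℕ} (hu : Ascending u a b)
    (hv : Ascending v a b) (ha : sigma u a = sigma v a) (hb : sigma u b = sigma v b) {j : ℕ}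
    (haj : a ≤ j) (hjb : j ≤ b) : sigma u j = sigma v j := by
  -- The labels at positions `a, ..., j` are the `x` that `σ_a` raises above `x` and `σ_{j+1}` does
  -- not. In an ascending chain the one at `j` is the largest of them.
  have lab : ∀ {u v : F n}, Ascending v a b → sigma u a = sigma v a →
      ∀ j : Fin (n - 1), a ≤ j → j < b → sigma u (j + 1) = sigma v (j + 1) →
        phi u j ≤ phi v j := by
    intro u v hv ha j haj hjb hj
    have h1 := lt_sigma_phi u j haj
    have h2 := sigma_phi_le u j (Nat.lt_succ_self j)
    rw [ha, lt_sigma_iff] at h1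
    rw [hj, ← not_lt, lt_sigma_iff] at h2
    set k := (phi v)⁻¹ (phi u j) with hk
    have hk' : phi u j = phi v k := by simp [hk]
    rw [hk']
    rcases (show k ≤ j from Fin.le_def.2 (by omega)).eq_or_lt with h3 | h3
    · rw [h3]
    · exact (hv k j h1 h3 hjb).le
  -- Descending induction from level `b`: the factor at `j` exchanges the images of the label under
  -- `σ_{j+1}` and `σ_j`, and by ascent the latter can be read at level `a`.
  have key : ∀ d, a ≤ b - d → sigma u (b - d) = sigma v (b - d) := by
    intro d
    induction d with
    | zero => exact fun _ => hb
    | succ d ih =>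
      intro hd
      have ih := ih (by omega)
      by_cases h0 : b ≤ d
      · rwa [show b - (d + 1) = b - d by omega]
      by_cases h2 : n - 1 ≤ b - (d + 1)
      · rw [sigma_of_le u h2, sigma_of_le v h2]
      let j : Fin (n - 1) := ⟨b - (d + 1), by omega⟩
      have hj : j.1 + 1 = b - d := by simp only [j]; omega
      have hja : a ≤ j := by simp only [j]; omega
      have hjb : j < b := by simp only [j]; omega
      change sigma u j = sigma v j
      rw [← hj] at ih
      have hphi : phi u j = phi v j :=
        le_antisymm (lab hv ha j hja hjb ih) (lab hu ha.symm j hja hjb ih.symm)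
      rw [sigma_eq_swap_mul u, sigma_eq_swap_mul v, ← hu.sigma_eq j hja hjb,
        ← hv.sigma_eq j hja hjb, hphi, ih, ha]
  have := key (b - j) (by omega)
  rwa [Nat.sub_sub_self hjb] at this

/-! ### Chains that differ in one element -/

/-- The permutations `σ_j` of the two chains agree for `j ≠ i + 1`. -/
def AgreeOff {n : ℕ} (i : ℕ) (u w : F n) : Prop := ∀ j, j ≠ i + 1 → sigma u j = sigma w j

theorem AgreeOff.symm {n i : ℕ} {u w : F n} (h : AgreeOff i u w) : AgreeOff i w u :=
  fun j hj => (h j hj).symm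

theorem AgreeOff.trans {n i : ℕ} {u v w : F n} (h : AgreeOff i u v) (h' : AgreeOff i v w) :
    AgreeOff i u w := fun j hj => (h j hj).trans (h' j hj)

theorem AgreeOff.refl {n : ℕ} (i : ℕ) (w : F n) : AgreeOff i w w := fun _ _ => rfl

/-- By `lt_sigma_iff`, the levels other than `i + 1` locate every label except for distinguishing
position `i` from position `i + 1`. -/
theorem AgreeOff.phi_eq {n i : ℕ} (h : i + 1 < n - 1) {u w : F n} (hu : AgreeOff i u w) :
    phi u = phi w ∨ phi u = phi w * adjSwap i h := by
  have key : ∀ k, (phi w)⁻¹ (phi u k) = k ∨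
      (k.1 = i ∧ ((phi w)⁻¹ (phi u k)).1 = i + 1) ∨
      (k.1 = i + 1 ∧ ((phi w)⁻¹ (phi u k)).1 = i) := by
    intro k
    have h1 : ∀ l, l ≠ i + 1 → (l ≤ k.1 ↔ l ≤ ((phi w)⁻¹ (phi u k)).1) := by
      intro l hl
      have h2 := lt_sigma_iff u (phi u k) l
      rw [hu l hl, lt_sigma_iff] at h2
      simpa using h2.symm
    rw [Fin.ext_iff]
    generalize ((phi w)⁻¹ (phi u k)).1 = b at *
    have h3 := h1 k.1
    have h4 := h1 b
    have h5 := h1 (k.1 + 1)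
    have h6 := h1 (b + 1)
    omega
  have hmul : phi u = phi w * ((phi w)⁻¹ * phi u) := by group
  have hk : ∀ k, ((phi w)⁻¹ * phi u) k = (phi w)⁻¹ (phi u k) := fun _ => rfl
  simp only [← hk] at key
  rw [hmul, mul_eq_left, mul_right_inj]
  generalize (phi w)⁻¹ * phi u = κ at *
  rcases key ⟨i, by omega⟩ with h1 | ⟨-, h1⟩ | ⟨h1, -⟩
  · left
    ext k
    rcases key k with h2 | ⟨h2, h3⟩ | ⟨h2, h3⟩
    · rw [h2]; rfl
    · rw [show k = ⟨i, by omega⟩ from Fin.ext h2, h1]; rfl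
    · have h4 : κ k = κ ⟨i, by omega⟩ := by rw [h1]; exact Fin.ext h3
      rw [κ.injective h4] at h2
      simp at h2
  · right
    have h1' : κ ⟨i, by omega⟩ = ⟨i + 1, h⟩ := Fin.ext h1
    ext k
    rw [adjSwap, swap_apply_def]
    split_ifs with h2 h3
    · rw [h2, h1]
    · rcases key k with h4 | ⟨h4, -⟩ | ⟨-, h4⟩
      · have := κ.injective ((h4.trans h3).trans h1'.symm)
        rw [this] at h3
        simp at h3
      · rw [h3] at h4
        simp at h4
      · exact h4
    · rcases key k with h4 | ⟨h4, -⟩ | ⟨h4, -⟩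
      · rw [h4]
      · exact absurd (Fin.ext h4) h2
      · exact absurd (Fin.ext h4) h3
  · simp at h1

/-! ### Partial products after a Hurwitz move -/

theorem slideR_drop_prod {n : ℕ} (i : ℕ) (l : List (Perm (Fin n))) (hl : ∀ t ∈ l, t.IsSwap)
    {j : ℕ} (hj : j ≠ i + 1) : ((slideR i l).drop j).prod = (l.drop j).prod := by
  induction i, l using slideR.induct generalizing j with
  | case1 s t l =>
    rcases j with _ | _ | j
    · exact (slideR_spec 0 _ hl).2.2
    · exact absurd rfl hj
    · rfl
  | case2 i s l ih =>
    rcases j with _ | j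
    · exact (slideR_spec _ _ hl).2.2
    · exact ih (fun t ht => hl t (List.mem_cons_of_mem _ ht)) (by omega)
  | case3 i l h1 h2 =>
    have : slideR i l = l := by rw [slideR]; exacts [h1, h2]
    rw [this]

theorem slideL_drop_prod {n : ℕ} (i : ℕ) (l : List (Perm (Fin n))) (hl : ∀ t ∈ l, t.IsSwap)
    {j : ℕ} (hj : j ≠ i + 1) : ((slideL i l).drop j).prod = (l.drop j).prod := by
  induction i, l using slideL.induct generalizing j with
  | case1 s t l =>
    rcases j with _ | _ | j
    · exact (slideL_spec 0 _ hl).2.2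
    · exact absurd rfl hj
    · rfl
  | case2 i s l ih =>
    rcases j with _ | j
    · exact (slideL_spec _ _ hl).2.2
    · exact ih (fun t ht => hl t (List.mem_cons_of_mem _ ht)) (by omega)
  | case3 i l h1 h2 =>
    have : slideL i l = l := by rw [slideL]; exacts [h1, h2]
    rw [this]

theorem slideR_drop_succ_prod {G : Type*} [Group G] (i : ℕ) (l : List G)
    (h : i + 1 < l.length) : ((slideR i l).drop (i + 1)).prod =
      (l.drop i).prod * (l.drop (i + 1)).prod⁻¹ * (l.drop (i + 2)).prod := by
  induction i, l using slideR.induct with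
  | case1 s t l =>
    simp only [slideR, List.drop_succ_cons, List.drop_zero, List.prod_cons]
    group
  | case2 i s l ih => exact ih (by simpa using h)
  | case3 i l h1 h2 =>
    exfalso
    rcases l with _ | ⟨s, _ | ⟨t, l⟩⟩
    · simp at h
    · simp at h
    · rcases i with _ | i
      · exact h1 s t l rfl rfl
      · exact h2 i s _ rfl rfl

theorem slideL_drop_succ_prod {G : Type*} [Group G] (i : ℕ) (l : List G)
    (h : i + 1 < l.length) : ((slideL i l).drop (i + 1)).prod =
      (l.drop (i + 2)).prod * (l.drop (i + 1)).prod⁻¹ * (l.drop i).prod := by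
  induction i, l using slideL.induct with
  | case1 s t l =>
    simp only [slideL, List.drop_succ_cons, List.drop_zero, List.prod_cons]
    group
  | case2 i s l ih => exact ih (by simpa using h)
  | case3 i l h1 h2 =>
    exfalso
    rcases l with _ | ⟨s, _ | ⟨t, l⟩⟩
    · simp at h
    · simp at h
    · rcases i with _ | i
      · exact h1 s t l rfl rfl
      · exact h2 i s _ rfl rfl

theorem agreeOff_R {n : ℕ} (i : ℕ) (w : F n) : AgreeOff i (R i w) w := by
  intro j hj
  rw [sigma, R, word_ofWord, slideR_drop_prod i _ (word_spec w).2.1 hj, sigma]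

theorem agreeOff_L {n : ℕ} (i : ℕ) (w : F n) : AgreeOff i (L i w) w := by
  intro j hj
  rw [sigma, L, word_ofWord, slideL_drop_prod i _ (word_spec w).2.1 hj, sigma]

theorem sigma_R {n i : ℕ} (h : i + 1 < n - 1) (w : F n) :
    sigma (R i w) (i + 1) = sigma w i * (sigma w (i + 1))⁻¹ * sigma w (i + 2) := by
  rw [sigma, R, word_ofWord, slideR_drop_succ_prod _ _ (by rwa [(word_spec w).1])]
  rfl

theorem sigma_L {n i : ℕ} (h : i + 1 < n - 1) (w : F n) :
    sigma (L i w) (i + 1) = sigma w (i + 2) * (sigma w (i + 1))⁻¹ * sigma w i := by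
  rw [sigma, L, word_ofWord, slideL_drop_succ_prod _ _ (by rwa [(word_spec w).1])]
  rfl

theorem AgreeOff.phi_eq_of_lt {n i : ℕ} (h : i + 1 < n - 1) {u w : F n} (hu : AgreeOff i u w)
    (hlt : hat (phi w ⟨i, by omega⟩) < sigma u (i + 1) (hat (phi w ⟨i, by omega⟩))) :
    phi u = phi w * adjSwap i h := by
  refine (hu.phi_eq h).resolve_left fun h1 => ?_
  rw [lt_sigma_iff, h1] at hlt
  simp at hlt

/-- One of the two Hurwitz moves at `i` exchanges the labels at `i` and `i + 1`. -/
theorem phi_R_or_phi_L {n i : ℕ} (h : i + 1 < n - 1) (w : F n) :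
    phi (R i w) = phi w * adjSwap i h ∨ phi (L i w) = phi w * adjSwap i h := by
  let k : Fin (n - 1) := ⟨i, by omega⟩
  let k' : Fin (n - 1) := ⟨i + 1, h⟩
  have hkk' : hat (phi w k) ≠ hat (phi w k') := by
    intro h1
    have := (phi w).injective (Fin.castLE_injective _ h1)
    simp [k, k'] at this
  have h1 : hat (phi w k) < sigma w i (hat (phi w k)) := lt_sigma_phi w k le_rfl
  have h2 : sigma w (i + 1) (hat (phi w k)) ≤ hat (phi w k) :=
    sigma_phi_le w k (Nat.lt_succ_self i)
  have h3 : sigma w (i + 2) (hat (phi w k)) ≤ hat (phi w k) :=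
    sigma_phi_le w k (by simp [k])
  have e1 : sigma w i = swap (sigma w (i + 1) (hat (phi w k))) (sigma w i (hat (phi w k))) *
    sigma w (i + 1) := sigma_eq_swap_mul w k
  have e2 : sigma w (i + 1) = swap (sigma w (i + 2) (hat (phi w k')))
    (sigma w (i + 1) (hat (phi w k'))) * sigma w (i + 2) := sigma_eq_swap_mul w k'
  -- It suffices that the label formerly at `i` is raised at the new level `i + 1`. If the factor at
  -- `i + 1` does not affect this label, `R` gives it the image under `σ_i`, which is above it.
  by_cases h4 : sigma w (i + 2) (hat (phi w k)) = sigma w (i + 1) (hat (phi w k))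
  · left
    refine (agreeOff_R i w).phi_eq_of_lt h ?_
    change hat (phi w k) < sigma (R i w) (i + 1) (hat (phi w k))
    rw [sigma_R h, Perm.mul_apply, Perm.mul_apply, h4]
    simpa using h1
  · right
    -- Otherwise both points exchanged by the factor at `i + 1` are images of this label and at most
    -- the label. Hence this factor fixes the image under `σ_i`, which is larger, and `L` works.
    have h5 : sigma w (i + 2) (hat (phi w k)) = sigma w (i + 1) (hat (phi w k')) := by
      by_contra h5
      apply h4
      conv_rhs => rw [e2, Perm.mul_apply]
      rw [swap_apply_of_ne_of_ne _ h5]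
      exact fun h6 => hkk' ((sigma w (i + 2)).injective h6)
    have h6 : sigma w (i + 1) (hat (phi w k)) = sigma w (i + 2) (hat (phi w k')) := by
      conv_lhs => rw [e2, Perm.mul_apply, h5]
      rw [swap_apply_right]
    refine (agreeOff_L i w).phi_eq_of_lt h ?_
    change hat (phi w k) < sigma (L i w) (i + 1) (hat (phi w k))
    have e3 : ∀ s : Perm (Fin n), s * s = 1 → sigma w (i + 1) = s * sigma w (i + 2) →
        sigma w (i + 2) * (sigma w (i + 1))⁻¹ = s := by
      intro s hs hM
      rw [mul_inv_eq_iff_eq_mul, hM, ← mul_assoc, hs, one_mul]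
    rw [sigma_L h, e3 _ (swap_mul_self _ _) e2, Perm.mul_apply, swap_apply_of_ne_of_ne]
    · exact h1
    · rw [← h6]
      exact (h2.trans_lt h1).ne'
    · rw [← h5]
      exact (h3.trans_lt h1).ne'

theorem not_isDescent_of_mul {n i : ℕ} (h : i + 1 < n - 1) {u w : F n}
    (hw : IsDescent (phi w) i) (hu : phi u = phi w * adjSwap i h) : ¬ IsDescent (phi u) i := by
  rw [hu, isDescent_mul_adjSwap, not_not]
  exact hw

theorem ascending_two {n i : ℕ} {w : F n} (hw : ¬ IsDescent (phi w) i) :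
    Ascending w i (i + 2) := by
  intro k l hk hkl hl
  rw [Fin.lt_def] at hkl
  by_contra! h1
  have hk' : k = ⟨i, by omega⟩ := Fin.ext (by simp only; omega)
  have hl' : l = ⟨i + 1, by omega⟩ := Fin.ext (by simp only; omega)
  refine hw ⟨by omega, ?_⟩
  rw [← hk', ← hl']
  exact lt_of_le_of_ne h1 fun h2 => hkl.ne' (congrArg Fin.val ((phi w).injective h2))

theorem ascending_three {n i : ℕ} {w : F n} (hw : ¬ IsDescent (phi w) i)
    (hw' : ¬ IsDescent (phi w) (i + 1)) : Ascending w i (i + 3) := by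
  intro k l hk hkl hl
  have h1 := ascending_two hw
  have h2 := ascending_two hw'
  rw [Fin.lt_def] at hkl
  by_cases hl2 : l.1 < i + 2
  · exact h1 k l hk hkl hl2
  by_cases hk1 : i + 1 ≤ k.1
  · exact h2 k l hk1 hkl hl
  have hln := l.2
  exact (h1 k ⟨i + 1, by omega⟩ hk (by simp [Fin.lt_def]; omega) (by simp)).trans
    (h2 ⟨i + 1, by omega⟩ l (by simp) (by simp [Fin.lt_def]; omega) hl)

/-- Both chains ascend between levels `i` and `i + 2`, where they agree, so uniqueness forces the
level in between. -/
theorem AgreeOff.eq_of_not_isDescent {n i : ℕ} {u v : F n} (h : AgreeOff i u v)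
    (hu : ¬ IsDescent (phi u) i) (hv : ¬ IsDescent (phi v) i) : u = v := by
  refine eq_of_sigma fun j => ?_
  by_cases hj : j = i + 1
  · exact sigma_eq_of_ascending (ascending_two hu) (ascending_two hv) (h i (by omega))
      (h (i + 2) (by omega)) (by omega) (by omega)
  · exact h j hj

theorem eq_of_phi_eq_one {n : ℕ} {u v : F n} (hu : phi u = 1) (hv : phi v = 1) : u = v := by
  refine eq_of_sigma fun j => ?_
  rcases le_or_gt (n - 1) j with hj | hj
  · rw [sigma_of_le u hj, sigma_of_le v hj]
  · refine sigma_eq_of_ascending (a := 0) (b := n - 1) ?_ ?_ ?_ ?_ (Nat.zero_le j) hj.le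
    · intro k l _ hkl _
      rw [hu]
      exact hkl
    · intro k l _ hkl _
      rw [hv]
      exact hkl
    · rw [sigma_zero, sigma_zero]
    · rw [sigma_of_le u le_rfl, sigma_of_le v le_rfl]

theorem phi_e (n : ℕ) : phi (e n) = 1 := by
  ext1 j
  rw [Perm.one_apply, eq_comm, ← sigma_lt_iff]
  -- The factors after position `j` move only letters above `j`.
  have hfix : sigma (e n) (j + 1) (hat j) = hat j := by
    have key : ∀ l : List (Perm (Fin n)), (∀ t ∈ l, t (hat j) = hat j) →
        l.prod (hat j) = hat j := by
      intro l
      induction l with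
      | nil => simp
      | cons t l ih =>
        intro h
        rw [List.prod_cons, Perm.mul_apply, ih fun s hs => h s (List.mem_cons_of_mem _ hs)]
        exact h t (by simp)
    apply key
    intro t ht
    rw [e, word_ofWord, List.mem_drop_iff_getElem] at ht
    obtain ⟨k, hk, rfl⟩ := ht
    simp only [eWord, List.getElem_ofFn]
    apply swap_apply_of_ne_of_ne <;> simp [Fin.ext_iff] <;> omega
  have hlen : j.1 < (word (e n)).length := by rw [(word_spec _).1]; exact j.2
  rw [sigma_eq_getElem_mul _ hlen, Perm.mul_apply, hfix]
  have : (word (e n))[j.1] = swap ⟨j.1, by omega⟩ ⟨j.1 + 1, by omega⟩ := by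
    simp only [e, word_ofWord, eWord, List.getElem_ofFn]
  rw [this]
  have hj : hat j = ⟨j.1, by omega⟩ := rfl
  rw [hj, swap_apply_left, Fin.lt_def]
  simp

/-! ### Adjacency and distance in the Hurwitz graph -/

/-- The element of rank `k` of a maximal chain. -/
noncomputable def elt {n : ℕ} (w : F n) (k : ℕ) : NC n :=
  ⟨((word w).take k).prod, (word_spec w).take_mem k⟩

theorem elt_mem {n : ℕ} (w : F n) (k : ℕ) : elt w k ∈ w := (mem_iff_word w _).2 ⟨k, rfl⟩

theorem exists_elt_eq {n : ℕ} {w : F n} {x : NC n} (h : x ∈ w) : ∃ k ≤ n - 1, x = elt w k := by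
  obtain ⟨k, hk⟩ := (mem_iff_word w x).1 h
  refine ⟨min k (n - 1), min_le_right _ _, Subtype.ext (hk.trans ?_)⟩
  change _ = (List.take (min k (n - 1)) (word w)).prod
  rw [List.take_eq_take_min, (word_spec w).1]

theorem reflLength_elt {n : ℕ} (w : F n) {k : ℕ} (hk : k ≤ n - 1) :
    reflLength (elt w k).1 = k :=
  (word_spec w).reflLength_take hk

theorem elt_eq_iff {n : ℕ} (u v : F n) (k : ℕ) : elt u k = elt v k ↔ sigma u k = sigma v k := by
  have h1 := take_prod_mul_sigma u k
  have h2 := take_prod_mul_sigma v k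
  constructor
  · intro h
    have h3 : ((word u).take k).prod = ((word v).take k).prod := congrArg Subtype.val h
    rw [← h2, h3] at h1
    exact mul_left_cancel h1
  · intro h
    rw [← h2, h] at h1
    exact Subtype.ext (mul_right_cancel h1)

/-- Reflection length is the rank, so a common element of two chains sits at the same index in both.
-/
theorem elt_mem_iff {n : ℕ} (u v : F n) {k : ℕ} (hk : k ≤ n - 1) :
    elt u k ∈ v ↔ sigma u k = sigma v k := by
  rw [← elt_eq_iff]
  constructor
  · intro h
    obtain ⟨j, hj, h1⟩ := exists_elt_eq h
    have h2 := congrArg (fun x : NC n => reflLength x.1) h1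
    simp only [reflLength_elt u hk, reflLength_elt v hj] at h2
    rw [h1, h2]
  · intro h
    rw [h]
    exact elt_mem v k

theorem AgreeOff.ncard_diff {n i : ℕ} {u v : F n} (h : AgreeOff i u v) (hne : u ≠ v) :
    ((u : Set (NC n)) \ v).ncard = 1 := by
  have hk : sigma u (i + 1) ≠ sigma v (i + 1) := by
    intro h1
    refine hne (eq_of_sigma fun j => ?_)
    by_cases hj : j = i + 1
    · rw [hj, h1]
    · exact h j hj
  have hi : i + 1 ≤ n - 1 := by
    by_contra hi
    apply hk
    rw [sigma_of_le u (by omega), sigma_of_le v (by omega)]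
  refine Set.ncard_eq_one.2 ⟨elt u (i + 1), Set.ext fun x => ⟨?_, ?_⟩⟩
  · rintro ⟨h1, h2⟩
    obtain ⟨k, hk, rfl⟩ := exists_elt_eq h1
    change ¬ elt u k ∈ v at h2
    rw [elt_mem_iff u v hk] at h2
    by_cases hki : k = i + 1
    · rw [hki]; rfl
    · exact absurd (h k hki) h2
  · rintro rfl
    exact ⟨elt_mem u _, fun h1 => hk ((elt_mem_iff u v hi).1 h1)⟩

theorem AgreeOff.adj {n i : ℕ} {u v : F n} (h : AgreeOff i u v) (hne : u ≠ v) :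
    (hurwitzGraph n).Adj u v :=
  ⟨h.ncard_diff hne, h.symm.ncard_diff hne.symm⟩

theorem exists_agreeOff {n : ℕ} {u v : F n} (h : (hurwitzGraph n).Adj u v) :
    ∃ i, i + 1 < n - 1 ∧ AgreeOff i u v := by
  obtain ⟨z, hz⟩ := Set.ncard_eq_one.1 h.1
  have hzm : z ∈ (u : Set (NC n)) \ v := by rw [hz]; rfl
  obtain ⟨k, hk, rfl⟩ := exists_elt_eq hzm.1
  have hkn : sigma u k ≠ sigma v k := fun h1 => hzm.2 ((elt_mem_iff u v hk).2 h1)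
  have hk0 : k ≠ 0 := by
    rintro rfl
    exact hkn (by rw [sigma_zero, sigma_zero])
  have hk1 : k ≠ n - 1 := by
    intro hk1
    exact hkn (by rw [sigma_of_le u hk1.ge, sigma_of_le v hk1.ge])
  -- `AgreeOff i` leaves level `i + 1` free, hence the shift. The bottom and top levels always
  -- agree, so `k` is interior.
  refine ⟨k - 1, by omega, fun j hj => ?_⟩
  by_contra hjn
  have hj1 : j ≤ n - 1 := by
    by_contra hj1
    exact hjn (by rw [sigma_of_le u (by omega), sigma_of_le v (by omega)])
  have hjm : elt u j ∈ (u : Set (NC n)) \ v :=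
    ⟨elt_mem u j, fun h1 => hjn ((elt_mem_iff u v hj1).1 h1)⟩
  rw [hz] at hjm
  have h2 := congrArg (fun x : NC n => reflLength x.1) (Set.mem_singleton_iff.1 hjm)
  simp only [reflLength_elt u hk, reflLength_elt u hj1] at h2
  omega

/-! ### Inversions as distance from `e` -/

/-- The number of inversions of `φ(w)`. -/
noncomputable def rk {n : ℕ} (w : F n) : ℕ := inv (phi w)

theorem rk_e (n : ℕ) : rk (e n) = 0 := by rw [rk, phi_e, inv_one]

theorem rk_le_of_adj {n : ℕ} {u v : F n} (h : (hurwitzGraph n).Adj u v) : rk v ≤ rk u + 1 := by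
  obtain ⟨i, hi, hA⟩ := exists_agreeOff h
  rw [rk, rk]
  rcases hA.symm.phi_eq hi with h1 | h1
  · rw [h1]
    omega
  · by_cases hd : IsDescent (phi u) i
    · have := inv_mul_adjSwap hi hd
      rw [← h1] at this
      omega
    · have := inv_mul_adjSwap_of_not hi hd
      rw [← h1] at this
      omega

theorem rk_le_of_walk {n : ℕ} {u v : F n} (p : (hurwitzGraph n).Walk u v) :
    rk v ≤ rk u + p.length := by
  induction p with
  | nil => simp
  | cons h p ih =>
    have := rk_le_of_adj h
    rw [SimpleGraph.Walk.length_cons]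
    omega

/-- One of the two Hurwitz moves at `i` leads to a neighbour with labels exchanged. -/
theorem exists_agreeOff_phi_eq {n i : ℕ} (h : i + 1 < n - 1) (w : F n) :
    ∃ u, AgreeOff i u w ∧ phi u = phi w * adjSwap i h :=
  (phi_R_or_phi_L h w).elim (fun h1 => ⟨_, agreeOff_R i w, h1⟩)
    fun h1 => ⟨_, agreeOff_L i w, h1⟩

theorem ne_of_phi_eq_mul {n i : ℕ} (h : i + 1 < n - 1) {u w : F n}
    (h1 : phi u = phi w * adjSwap i h) : u ≠ w := by
  rintro rfl
  have := congrFun (congrArg DFunLike.coe (mul_eq_left.1 h1.symm)) ⟨i, by omega⟩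
  simp [adjSwap] at this

/-- Each descent allows a step to a neighbour with one inversion fewer. The walk can only stop at
`e`, the unique chain with identity labels. -/
theorem exists_walk_length_eq_rk {n : ℕ} (w : F n) :
    ∃ p : (hurwitzGraph n).Walk w (e n), p.length = rk w := by
  induction hr : rk w using Nat.strong_induction_on generalizing w with
  | _ r ih =>
    by_cases h1 : phi w = 1
    · obtain rfl := eq_of_phi_eq_one h1 (phi_e n)
      exact ⟨.nil, by rw [← hr, rk_e]; rfl⟩
    · obtain ⟨i, hi⟩ := exists_isDescent h1
      obtain ⟨u, hu, hphi⟩ := exists_agreeOff_phi_eq hi.1 w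
      have h2 := inv_mul_adjSwap hi.1 hi
      rw [← hphi] at h2
      obtain ⟨p, hp⟩ := ih (rk u) (by rw [← hr, rk, rk]; omega) u rfl
      refine ⟨.cons (hu.adj (ne_of_phi_eq_mul hi.1 hphi)).symm p, ?_⟩
      rw [SimpleGraph.Walk.length_cons, hp, ← hr]
      exact h2

theorem hurwitzGraph_connected (n : ℕ) : (hurwitzGraph n).Connected :=
  (SimpleGraph.connected_iff_exists_forall_reachable _).2
    ⟨e n, fun w => (exists_walk_length_eq_rk w).elim fun p _ => p.reverse.reachable⟩

theorem dist_e {n : ℕ} (w : F n) : (hurwitzGraph n).dist (e n) w = rk w := by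
  apply le_antisymm
  · obtain ⟨p, hp⟩ := exists_walk_length_eq_rk w
    rw [← hp, ← p.length_reverse]
    exact SimpleGraph.dist_le _
  · obtain ⟨p, hp⟩ := (hurwitzGraph_connected n).exists_walk_length_eq_dist (e n) w
    have := rk_le_of_walk p
    rw [rk_e] at this
    omega

/-! ### The weak order -/

theorem weakLE_iff {n : ℕ} (u v : F n) :
    weakLE u v ↔ rk u + (hurwitzGraph n).dist u v = rk v := by
  classical
  constructor
  · rintro ⟨p, hp, hu⟩
    have h1 := congrArg SimpleGraph.Walk.length (p.take_spec hu)
    rw [SimpleGraph.Walk.length_append, hp, dist_e] at h1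
    have h2 := SimpleGraph.dist_le (p.takeUntil u hu)
    have h3 := SimpleGraph.dist_le (p.dropUntil u hu)
    have h4 := (hurwitzGraph_connected n).dist_triangle (u := e n) (v := u) (w := v)
    rw [dist_e] at h2
    rw [dist_e, dist_e] at h4
    omega
  · intro h
    obtain ⟨p, hp⟩ := (hurwitzGraph_connected n).exists_walk_length_eq_dist (e n) u
    obtain ⟨q, hq⟩ := (hurwitzGraph_connected n).exists_walk_length_eq_dist u v
    refine ⟨p.append q, ?_, ?_⟩
    · rw [SimpleGraph.Walk.length_append, hp, hq, dist_e, dist_e, h]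
    · rw [SimpleGraph.Walk.mem_support_append_iff]
      exact Or.inl p.end_mem_support

theorem weakLE_refl {n : ℕ} (u : F n) : weakLE u u := by simp [weakLE_iff]

theorem weakLE_trans {n : ℕ} {u v w : F n} (h1 : weakLE u v) (h2 : weakLE v w) :
    weakLE u w := by
  rw [weakLE_iff] at *
  have h3 := (hurwitzGraph_connected n).dist_triangle (u := e n) (v := u) (w := w)
  have h4 := (hurwitzGraph_connected n).dist_triangle (u := u) (v := v) (w := w)
  rw [dist_e, dist_e] at h3
  omega

theorem weakLE_antisymm {n : ℕ} {u v : F n} (h1 : weakLE u v) (h2 : weakLE v u) : u = v := by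
  rw [weakLE_iff] at *
  exact (hurwitzGraph_connected n).dist_eq_zero_iff.1 (by omega)

theorem isPartialOrder_weakLE (n : ℕ) : IsPartialOrder (F n) weakLE where
  refl := weakLE_refl
  trans _ _ _ := weakLE_trans
  antisymm _ _ := weakLE_antisymm

theorem e_weakLE {n : ℕ} (w : F n) : weakLE (e n) w := by
  rw [weakLE_iff, rk_e, dist_e, zero_add]

/-- If the labels coincided, the ranks would too, and comparability would force distance zero. If
they are exchanged, the rank drops by one along an edge. -/
theorem AgreeOff.weakLT_iff {n i : ℕ} {u w : F n} (h : AgreeOff i u w)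
    (hd : IsDescent (phi w) i) : weakLT u w ↔ phi u = phi w * adjSwap i hd.1 := by
  constructor
  · rintro ⟨h1, h2⟩
    refine (h.phi_eq hd.1).resolve_left fun h3 => h2 ?_
    rw [weakLE_iff, rk, rk, h3] at h1
    exact (hurwitzGraph_connected n).dist_eq_zero_iff.1 (by omega)
  · intro h1
    have hne := ne_of_phi_eq_mul hd.1 h1
    refine ⟨?_, hne⟩
    rw [weakLE_iff, SimpleGraph.dist_eq_one_iff_adj.2 (h.adj hne), rk, h1]
    exact inv_mul_adjSwap hd.1 hd

/-! ### Down operators -/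

theorem weakLT_R_or_weakLT_L {n i : ℕ} {w : F n} (hd : IsDescent (phi w) i) :
    weakLT (R i w) w ∨ weakLT (L i w) w := by
  rw [(agreeOff_R i w).weakLT_iff hd, (agreeOff_L i w).weakLT_iff hd]
  exact phi_R_or_phi_L hd.1 w

theorem down_of_not_isDescent {n i : ℕ} {w : F n} (hd : ¬ IsDescent (phi w) i) :
    down i w = w := if_neg hd

theorem agreeOff_down {n : ℕ} (i : ℕ) (w : F n) : AgreeOff i (down i w) w := by
  unfold down
  split_ifs
  · exact agreeOff_R i w
  · exact agreeOff_L i w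
  all_goals exact AgreeOff.refl i w

theorem phi_down {n i : ℕ} {w : F n} (hd : IsDescent (phi w) i) :
    phi (down i w) = phi w * adjSwap i hd.1 := by
  unfold down
  rw [if_pos hd]
  split_ifs with h1 h2
  · exact ((agreeOff_R i w).weakLT_iff hd).1 h1
  · exact ((agreeOff_L i w).weakLT_iff hd).1 h2
  · exact absurd (weakLT_R_or_weakLT_L hd) (by simp [h1, h2])

theorem not_isDescent_down {n : ℕ} (i : ℕ) (w : F n) : ¬ IsDescent (phi (down i w)) i := by
  by_cases hd : IsDescent (phi w) i
  · exact not_isDescent_of_mul hd.1 hd (phi_down hd)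
  · rwa [down_of_not_isDescent hd]

/-- This characterizes the down operator without reference to `R` and `L`; in particular, the two
moves coincide when both go down. -/
theorem AgreeOff.eq_down {n i : ℕ} {u w : F n} (h : AgreeOff i u w)
    (hd : ¬ IsDescent (phi u) i) : down i w = u :=
  ((agreeOff_down i w).trans h.symm).eq_of_not_isDescent (not_isDescent_down i w) hd

theorem AgreeOff.down_eq_of_weakLT {n i : ℕ} {u w : F n} (h : AgreeOff i u w)
    (hd : IsDescent (phi w) i) (hlt : weakLT u w) : down i w = u :=
  h.eq_down (not_isDescent_of_mul hd.1 hd ((h.weakLT_iff hd).1 hlt))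

theorem down_down {n : ℕ} (i : ℕ) (w : F n) : down i (down i w) = down i w :=
  down_of_not_isDescent (not_isDescent_down i w)

theorem down_weakLE {n : ℕ} (i : ℕ) (w : F n) : weakLE (down i w) w := by
  by_cases hd : IsDescent (phi w) i
  · exact (((agreeOff_down i w).weakLT_iff hd).2 (phi_down hd)).1
  · rw [down_of_not_isDescent hd]
    exact weakLE_refl w

theorem down_mem_lowerInterval {n : ℕ} (i : ℕ) {v w : F n} (hv : v ∈ lowerInterval w) :
    down i v ∈ lowerInterval w :=
  ⟨e_weakLE _, weakLE_trans (down_weakLE i v) hv.2⟩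

theorem phi_down_left {n i : ℕ} (h : i + 1 < n - 1) (w : F n) :
    phi (down i w) ⟨i, by omega⟩ = min (phi w ⟨i, by omega⟩) (phi w ⟨i + 1, h⟩) := by
  by_cases hd : IsDescent (phi w) i
  · rw [phi_down hd, Perm.mul_apply, adjSwap, swap_apply_left, min_eq_right hd.2.le]
  · rw [down_of_not_isDescent hd, min_eq_left]
    exact not_lt.1 fun h1 => hd ⟨h, h1⟩

theorem phi_down_right {n i : ℕ} (h : i + 1 < n - 1) (w : F n) :
    phi (down i w) ⟨i + 1, h⟩ = max (phi w ⟨i, by omega⟩) (phi w ⟨i + 1, h⟩) := by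
  by_cases hd : IsDescent (phi w) i
  · rw [phi_down hd, Perm.mul_apply, adjSwap, swap_apply_right, max_eq_left hd.2.le]
  · rw [down_of_not_isDescent hd, max_eq_right]
    exact not_lt.1 fun h1 => hd ⟨h, h1⟩

theorem phi_down_of_ne {n i : ℕ} (w : F n) {k : Fin (n - 1)} (h1 : k.1 ≠ i) (h2 : k.1 ≠ i + 1) :
    phi (down i w) k = phi w k := by
  by_cases hd : IsDescent (phi w) i
  · rw [phi_down hd, Perm.mul_apply, adjSwap, swap_apply_of_ne_of_ne]
    · exact fun h => h1 (congrArg Fin.val h)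
    · exact fun h => h2 (congrArg Fin.val h)
  · rw [down_of_not_isDescent hd]

theorem isDescent_down_iff {n i j : ℕ} (hij : i + 1 < j ∨ j + 1 < i) (w : F n) :
    IsDescent (phi (down j w)) i ↔ IsDescent (phi w) i := by
  refine exists_congr fun h => ?_
  rw [phi_down_of_ne w (by simp only; omega) (by simp only; omega),
    phi_down_of_ne w (by simp only; omega) (by simp only; omega)]

/-- The two operators change different levels and sort disjoint pairs of labels. At each changed
level both sides are ascending between the same unchanged neighbours. -/
theorem down_comm {n i j : ℕ} (hij : i + 1 < j ∨ j + 1 < i) (w : F n) :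
    down i (down j w) = down j (down i w) := by
  have key : ∀ {i j : ℕ}, i + 1 < j ∨ j + 1 < i →
      sigma (down i (down j w)) (i + 1) = sigma (down j (down i w)) (i + 1) := by
    intro i j hij
    have h1 : ¬ IsDescent (phi (down j (down i w))) i := by
      rw [isDescent_down_iff hij]
      exact not_isDescent_down i w
    refine sigma_eq_of_ascending (ascending_two (not_isDescent_down i _)) (ascending_two h1)
      ?_ ?_ (Nat.le_succ i) (Nat.le_succ (i + 1))
    all_goals
      rw [agreeOff_down i _ _ (by omega), agreeOff_down j _ _ (by omega),
        agreeOff_down j _ _ (by omega), agreeOff_down i _ _ (by omega)]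
  refine eq_of_sigma fun k => ?_
  by_cases hki : k = i + 1
  · rw [hki, key hij]
  by_cases hkj : k = j + 1
  · rw [hkj, key hij.symm]
  rw [agreeOff_down i _ _ hki, agreeOff_down j _ _ hkj, agreeOff_down j _ _ hkj,
    agreeOff_down i _ _ hki]

theorem eq_of_not_isDescent_pair {n i : ℕ} {u v : F n}
    (h : ∀ k, k ≠ i + 1 → k ≠ i + 2 → sigma u k = sigma v k)
    (hu : ¬ IsDescent (phi u) i) (hu' : ¬ IsDescent (phi u) (i + 1))
    (hv : ¬ IsDescent (phi v) i) (hv' : ¬ IsDescent (phi v) (i + 1)) : u = v := by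
  refine eq_of_sigma fun k => ?_
  by_cases hk : k = i + 1 ∨ k = i + 2
  · exact sigma_eq_of_ascending (ascending_three hu hu') (ascending_three hv hv')
      (h i (by omega) (by omega)) (h (i + 3) (by omega) (by omega)) (by omega) (by omega)
  · exact h k (by omega) (by omega)

/-- Both words sort the three labels at `i`, `i + 1`, `i + 2` and change only the two levels in
between, so both sides are the same ascending stretch. -/
theorem down_braid {n i : ℕ} (hi : i + 2 < n - 1) (w : F n) :
    down i (down (i + 1) (down i w)) = down (i + 1) (down i (down (i + 1) w)) := by
  have hl : ∀ w : F n, phi (down (i + 1) w) ⟨i, by omega⟩ = phi w ⟨i, by omega⟩ :=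
    fun w => phi_down_of_ne w (by simp only; omega) (by simp only; omega)
  have hr : ∀ w : F n, phi (down i w) ⟨i + 2, hi⟩ = phi w ⟨i + 2, hi⟩ :=
    fun w => phi_down_of_ne w (by simp only; omega) (by simp only; omega)
  have h1 : i + 1 < n - 1 := by omega
  apply eq_of_not_isDescent_pair (i := i)
  · intro k hk1 hk2
    rw [agreeOff_down i _ k hk1, agreeOff_down (i + 1) _ k hk2, agreeOff_down i _ k hk1,
      agreeOff_down (i + 1) _ k hk2, agreeOff_down i _ k hk1, agreeOff_down (i + 1) _ k hk2]
  · exact not_isDescent_down i _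
  -- The last operator sorts only one of the two pairs; for the other, the labels are written out by
  -- `min` and `max`.
  · rintro ⟨_, h⟩
    simp only [hr, phi_down_right h1, phi_down_right hi, phi_down_left h1, phi_down_left hi,
      hl] at h
    exact absurd h (by simp)
  · rintro ⟨_, h⟩
    simp only [hr, phi_down_right h1, phi_down_right hi, phi_down_left h1, phi_down_left hi,
      hl] at h
    exact absurd h (not_lt.2 (le_min ((min_le_left _ _).trans (le_max_left _ _))
      ((min_le_right _ _).trans min_le_max)))
  · exact not_isDescent_down (i + 1) _

/-! ### Normal forms in the `0`-Hecke algebra -/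

/-- Elements `x_0, ..., x_{k-1}` of a monoid satisfying the relations of the `0`-Hecke monoid. -/
structure IsHeckeFamily {M : Type*} [Monoid M] (k : ℕ) (x : ℕ → M) : Prop where
  idem : ∀ i < k, x i * x i = x i
  comm : ∀ i j, j < k → i + 1 < j → x i * x j = x j * x i
  braid : ∀ i, i + 1 < k → x i * x (i + 1) * x i = x (i + 1) * x i * x (i + 1)

theorem IsHeckeFamily.mono {M : Type*} [Monoid M] {k l : ℕ} {x : ℕ → M} (h : IsHeckeFamily k x)
    (hl : l ≤ k) : IsHeckeFamily l x :=
  ⟨fun i hi => h.idem i (hi.trans_le hl), fun i j hj => h.comm i j (hj.trans_le hl),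
    fun i hi => h.braid i (hi.trans_le hl)⟩

/-- The product `x_k x_{k-1} ⋯ x_{k-d+1}`. -/
def descProd {M : Type*} [Monoid M] (x : ℕ → M) (k : ℕ) : ℕ → M
  | 0 => 1
  | d + 1 => descProd x k d * x (k - d)

/-- The normal forms of length `k`. -/
def normalForms {M : Type*} [Monoid M] (x : ℕ → M) : ℕ → Set M
  | 0 => {1}
  | k + 1 => Set.image2 (fun a d => a * descProd x k d) (normalForms x k) (Set.Iic (k + 1))

theorem normalForms_finite {M : Type*} [Monoid M] (x : ℕ → M) (k : ℕ) :
    (normalForms x k).Finite := by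
  induction k with
  | zero => exact Set.finite_singleton 1
  | succ k ih => exact ih.image2 _ (Set.finite_Iic _)

/-- A generator added to `k` others contributes a descending product of one of `k + 2` lengths. -/
theorem ncard_normalForms_le {M : Type*} [Monoid M] (x : ℕ → M) (k : ℕ) :
    (normalForms x k).ncard ≤ (k + 1).factorial := by
  induction k with
  | zero => simp [normalForms]
  | succ k ih =>
    have h1 : (Set.Iic (k + 1)).ncard = k + 2 := by
      rw [Set.ncard_eq_toFinset_card']
      simp
    rw [normalForms, ← Set.image_prod, Nat.factorial_succ, mul_comm]
    refine (Set.ncard_image_le ((normalForms_finite x k).prod (Set.finite_Iic _))).trans ?_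
    rw [Set.ncard_prod, h1]
    exact Nat.mul_le_mul_right _ ih

theorem one_mem_normalForms {M : Type*} [Monoid M] (x : ℕ → M) (k : ℕ) :
    (1 : M) ∈ normalForms x k := by
  induction k with
  | zero => rfl
  | succ k ih => exact ⟨1, ih, 0, by simp, by simp [descProd]⟩

theorem IsHeckeFamily.descProd_comm {M : Type*} [Monoid M] {k : ℕ} {x : ℕ → M}
    (h : IsHeckeFamily (k + 1) x) {d j : ℕ} (hj : j + d < k) :
    descProd x k d * x j = x j * descProd x k d := by
  induction d with
  | zero => simp [descProd]
  | succ d ih =>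
    rw [descProd, mul_assoc, ← h.comm j (k - d) (by omega) (by omega), ← mul_assoc,
      ih (by omega), mul_assoc]

/-- The factor `x_j` commutes leftwards until it meets `x_j x_{j-1}`. The braid relation then turns
it into an `x_{j-1}` on the left, which commutes with the larger indices. -/
theorem IsHeckeFamily.descProd_mul_of_lt {M : Type*} [Monoid M] {k : ℕ} {x : ℕ → M}
    (h : IsHeckeFamily (k + 1) x) {d j : ℕ} (hd : d ≤ k + 1) (hj : k + 1 < j + d) (hjk : j ≤ k) :
    ∃ i < k, descProd x k d * x j = x i * descProd x k d := by
  induction d generalizing j with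
  | zero => omega
  | succ d ih =>
    by_cases h1 : k + 1 < j + d
    · obtain ⟨i, hi, h2⟩ := ih (by omega) h1 hjk
      refine ⟨i, hi, ?_⟩
      rw [descProd, mul_assoc, h.comm (k - d) j (by omega) (by omega), ← mul_assoc, h2,
        mul_assoc]
    · obtain ⟨d, rfl⟩ : ∃ d', d = d' + 1 := ⟨d - 1, by omega⟩
      obtain rfl : j = k - d := by omega
      refine ⟨k - (d + 1), by omega, ?_⟩
      have h2 := h.braid (k - (d + 1)) (by omega)
      rw [show k - (d + 1) + 1 = k - d by omega] at h2
      have h3 := h.descProd_comm (d := d) (j := k - (d + 1)) (by omega)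
      simp only [descProd]
      rw [mul_assoc, mul_assoc, ← mul_assoc (x (k - d)), ← h2, ← mul_assoc, ← mul_assoc, h3]
      simp only [mul_assoc]

/-- Depending on `j + d`, the new factor passes through the descending product unchanged, prolongs
it, is absorbed by its last factor, or passes through with a different index. Whatever emerges on
the left is handled by induction. -/
theorem IsHeckeFamily.mul_mem_normalForms {M : Type*} [Monoid M] {k : ℕ} {x : ℕ → M}
    (h : IsHeckeFamily k x) {a : M} (ha : a ∈ normalForms x k) {j : ℕ} (hj : j < k) :
    a * x j ∈ normalForms x k := by
  induction k generalizing a j with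
  | zero => omega
  | succ k ih =>
    obtain ⟨b, hb, d, hd, rfl⟩ := ha
    have ih := fun {b : M} => ih (h.mono (Nat.le_succ k)) (a := b)
    simp only [Set.mem_Iic] at hd
    simp only [mul_assoc]
    rcases lt_trichotomy (j + d) k with h1 | h1 | h1
    · rw [h.descProd_comm h1, ← mul_assoc]
      exact ⟨_, ih hb (by omega), d, hd, rfl⟩
    · refine ⟨b, hb, d + 1, by simp only [Set.mem_Iic]; omega, ?_⟩
      simp only [descProd]
      rw [show k - d = j by omega]
    · by_cases h2 : j + d = k + 1
      · obtain ⟨d, rfl⟩ : ∃ d', d = d' + 1 := ⟨d - 1, by omega⟩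
        refine ⟨b, hb, d + 1, hd, ?_⟩
        simp only [descProd]
        rw [mul_assoc, show k - d = j by omega, h.idem j (by omega)]
      · obtain ⟨i, hi, h3⟩ := h.descProd_mul_of_lt hd (by omega) (by omega : j ≤ k)
        rw [h3, ← mul_assoc]
        exact ⟨_, ih hb hi, d, hd, rfl⟩

/-! ### The dimension bound for the `0`-Hecke algebra -/

theorem Hecke0.T_idem {m : ℕ} (i : Fin (m - 1)) : Hecke0.T i * Hecke0.T i = Hecke0.T i := by
  simpa only [Hecke0.T, map_mul] using RingQuot.mkAlgHom_rel ℚ (HeckeRel.idem i)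

theorem Hecke0.T_comm {m : ℕ} (i j : Fin (m - 1)) (h : i.1 + 1 < j.1 ∨ j.1 + 1 < i.1) :
    Hecke0.T i * Hecke0.T j = Hecke0.T j * Hecke0.T i := by
  simpa only [Hecke0.T, map_mul] using RingQuot.mkAlgHom_rel ℚ (HeckeRel.comm i j h)

theorem Hecke0.T_braid {m : ℕ} (i j : Fin (m - 1)) (h : j.1 = i.1 + 1) :
    Hecke0.T i * Hecke0.T j * Hecke0.T i = Hecke0.T j * Hecke0.T i * Hecke0.T j := by
  simpa only [Hecke0.T, map_mul] using RingQuot.mkAlgHom_rel ℚ (HeckeRel.braid i j h)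

theorem Hecke0.induction {m : ℕ} {P : Hecke0 m → Prop} (x : Hecke0 m)
    (algebraMap : ∀ r : ℚ, P (algebraMap ℚ _ r)) (T : ∀ i, P (Hecke0.T i))
    (mul : ∀ x y, P x → P y → P (x * y)) (add : ∀ x y, P x → P y → P (x + y)) : P x := by
  obtain ⟨y, rfl⟩ := RingQuot.mkAlgHom_surjective ℚ (HeckeRel m) x
  induction y using FreeAlgebra.induction with
  | grade0 r => rw [AlgHom.commutes]; exact algebraMap r
  | grade1 i => exact T i
  | mul a b ha hb => rw [map_mul]; exact mul _ _ ha hb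
  | add a b ha hb => rw [map_add]; exact add _ _ ha hb

/-- The generators of `H_m(0)`, extended by `1`. -/
noncomputable def Hecke0.gen (m : ℕ) (i : ℕ) : Hecke0 m :=
  if h : i < m - 1 then Hecke0.T ⟨i, h⟩ else 1

theorem Hecke0.isHeckeFamily_gen (m : ℕ) : IsHeckeFamily (m - 1) (Hecke0.gen m) where
  idem i hi := by
    rw [gen, dif_pos hi, T_idem]
  comm i j hj hij := by
    rw [gen, gen, dif_pos hj, dif_pos (by omega : i < m - 1), T_comm _ _ (Or.inl hij)]
  braid i hi := by
    rw [gen, gen, dif_pos hi, dif_pos (by omega : i < m - 1), T_braid _ _ rfl]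

theorem Hecke0.span_normalForms (m : ℕ) :
    Submodule.span ℚ (normalForms (Hecke0.gen m) (m - 1)) = ⊤ := by
  set S := Submodule.span ℚ (normalForms (Hecke0.gen m) (m - 1))
  -- The span is a right ideal; as it contains `1`, it is everything.
  have key : ∀ x : Hecke0 m, ∀ a ∈ S, a * x ∈ S := by
    intro x
    induction x using Hecke0.induction with
    | algebraMap r =>
      intro a ha
      rw [← Algebra.commutes, ← Algebra.smul_def]
      exact S.smul_mem r ha
    | T i =>
      intro a ha
      induction ha using Submodule.span_induction with
      | mem b hb =>
        apply Submodule.subset_span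
        have := (isHeckeFamily_gen m).mul_mem_normalForms hb i.2
        rwa [gen, dif_pos i.2] at this
      | zero => rw [zero_mul]; exact S.zero_mem
      | add b c _ _ hb hc => rw [add_mul]; exact S.add_mem hb hc
      | smul r b _ hb => rw [smul_mul_assoc]; exact S.smul_mem r hb
    | mul x y hx hy =>
      intro a ha
      rw [← mul_assoc]
      exact hy _ (hx a ha)
    | add x y hx hy =>
      intro a ha
      rw [mul_add]
      exact S.add_mem (hx a ha) (hy a ha)
  rw [eq_top_iff]
  rintro x -
  rw [← one_mul x]
  exact key x 1 (Submodule.subset_span (one_mem_normalForms _ _))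

theorem Hecke0.finite (m : ℕ) : Module.Finite ℚ (Hecke0 m) :=
  ⟨Submodule.fg_def.2 ⟨_, normalForms_finite _ _, span_normalForms m⟩⟩

theorem Hecke0.finrank_le (m : ℕ) : Module.finrank ℚ (Hecke0 m) ≤ m.factorial := by
  have hf := normalForms_finite (gen m) (m - 1)
  have h1 := finrank_span_finset_le_card (R := ℚ) hf.toFinset
  rw [Set.Finite.coe_toFinset, ← Set.ncard_eq_toFinset_card _ hf] at h1
  have h2 := ncard_normalForms_le (gen m) (m - 1)
  rw [Set.finrank, span_normalForms, finrank_top] at h1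
  rw [show (m - 1 + 1).factorial = m.factorial by cases m <;> rfl] at h2
  exact h1.trans h2

/-! ### The action on maximal chains -/

/-- The linear map of `ℚ F_n` given by a down operator. -/
noncomputable def downEnd {n : ℕ} (i : ℕ) : Module.End ℚ (F n →₀ ℚ) :=
  Finsupp.lmapDomain ℚ ℚ (down i)

theorem downEnd_single {n : ℕ} (i : ℕ) (w : F n) (r : ℚ) :
    downEnd i (Finsupp.single w r) = Finsupp.single (down i w) r := by
  rw [downEnd, Finsupp.lmapDomain_apply, Finsupp.mapDomain_single]

/-- The action of `H_{n-1}(0)` on `ℚ F_n`. -/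
noncomputable def action (n : ℕ) : Hecke0 (n - 1) →ₐ[ℚ] Module.End ℚ (F n →₀ ℚ) :=
  RingQuot.liftAlgHom ℚ ⟨FreeAlgebra.lift ℚ fun i : Fin (n - 1 - 1) => downEnd i.1, by
    intro x y h
    induction h with
    | idem i =>
      simp only [map_mul, FreeAlgebra.lift_ι_apply]
      ext1 w
      ext1
      simp only [LinearMap.comp_apply, Module.End.mul_apply, Finsupp.lsingle_apply,
        downEnd_single, down_down]
    | comm i j h =>
      simp only [map_mul, FreeAlgebra.lift_ι_apply]
      ext1 w
      ext1
      simp only [LinearMap.comp_apply, Module.End.mul_apply, Finsupp.lsingle_apply,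
        downEnd_single]
      rw [down_comm h]
    | braid i j h =>
      simp only [map_mul, FreeAlgebra.lift_ι_apply]
      ext1 w
      ext1
      simp only [LinearMap.comp_apply, Module.End.mul_apply, Finsupp.lsingle_apply,
        downEnd_single, h]
      rw [down_braid (by omega)]⟩

theorem action_T {n : ℕ} (i : Fin (n - 1 - 1)) : action n (Hecke0.T i) = downEnd i.1 := by
  rw [action, Hecke0.T, RingQuot.liftAlgHom_mkAlgHom_apply, FreeAlgebra.lift_ι_apply]

theorem action_mem_supported {n : ℕ} (w : F n) (x : Hecke0 (n - 1)) :
    ∀ f ∈ Finsupp.supported ℚ ℚ (lowerInterval w),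
      action n x f ∈ Finsupp.supported ℚ ℚ (lowerInterval w) := by
  induction x using Hecke0.induction with
  | algebraMap r =>
    intro f hf
    rw [AlgHom.commutes, Module.algebraMap_end_apply]
    exact Submodule.smul_mem _ r hf
  | T i =>
    intro f hf
    rw [action_T, downEnd]
    have h1 : lowerInterval w ⊆ down i.1 ⁻¹' lowerInterval w :=
      fun v hv => down_mem_lowerInterval i.1 hv
    have h2 := (Finsupp.supported_comap_lmapDomain ℚ ℚ (down i.1) (lowerInterval w))
      (Finsupp.supported_mono h1 hf)
    exact h2
  | mul x y hx hy =>
    intro f hf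
    rw [map_mul, Module.End.mul_apply]
    exact hx _ (hy f hf)
  | add x y hx hy =>
    intro f hf
    rw [map_add, LinearMap.add_apply]
    exact Submodule.add_mem _ (hx f hf) (hy f hf)

/-! ### Faithfulness -/

theorem phi_surjective (n : ℕ) : Function.Surjective (phi : F n → Perm (Fin (n - 1))) := by
  intro π
  induction hr : inv π using Nat.strong_induction_on generalizing π with
  | _ r ih =>
    by_cases h1 : π = 1
    · exact ⟨e n, by rw [phi_e, h1]⟩
    · obtain ⟨i, hi⟩ := exists_isDescent h1
      have h2 := inv_mul_adjSwap hi.1 hi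
      obtain ⟨w, hw⟩ := ih _ (by omega) (π * adjSwap i hi.1) rfl
      obtain ⟨u, -, hu⟩ := exists_agreeOff_phi_eq hi.1 w
      exact ⟨u, by rw [hu, hw, mul_assoc, adjSwap_mul_self, mul_one]⟩

theorem exists_action_single {n : ℕ} {w : F n} (hw : phi w = Fin.revPerm)
    (π : Perm (Fin (n - 1))) : ∃ (x : Hecke0 (n - 1)) (u : F n),
      action n x (Finsupp.single w 1) = Finsupp.single u 1 ∧ phi u = π := by
  -- Induction from the longest element downwards: an ascent of `π` gives a permutation with one
  -- more inversion, and the down operator at `i` undoes that exchange.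
  induction hr : (n - 1) * (n - 1) - inv π using Nat.strong_induction_on generalizing π with
  | _ r ih =>
    by_cases h1 : π = Fin.revPerm
    · exact ⟨1, w, by rw [map_one, Module.End.one_apply], by rw [hw, h1]⟩
    · obtain ⟨i, hi, h2⟩ := exists_not_isDescent h1
      have h3 := inv_mul_adjSwap_of_not hi h2
      have h4 := inv_le (π * adjSwap i hi)
      obtain ⟨x, u, hx, hu⟩ := ih _ (by omega) (π * adjSwap i hi) rfl
      have h5 : IsDescent (phi u) i := by rwa [hu, isDescent_mul_adjSwap]
      refine ⟨Hecke0.T ⟨i, by omega⟩ * x, down i u, ?_, ?_⟩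
      · rw [map_mul, Module.End.mul_apply, hx, action_T, downEnd_single]
      · rw [phi_down h5, hu, mul_assoc, adjSwap_mul_self, mul_one]

theorem action_injective (n : ℕ) : Function.Injective (action n) := by
  obtain ⟨w, hw⟩ := phi_surjective n Fin.revPerm
  let ev : Hecke0 (n - 1) →ₗ[ℚ] Perm (Fin (n - 1)) →₀ ℚ :=
    Finsupp.lmapDomain ℚ ℚ phi ∘ₗ LinearMap.applyₗ (Finsupp.single w 1) ∘ₗ
      (action n).toLinearMap
  have hev : ∀ x, ev x = Finsupp.mapDomain phi (action n x (Finsupp.single w 1)) := fun _ => rfl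
  have hsurj : Function.Surjective ev := by
    rw [← LinearMap.range_eq_top, eq_top_iff]
    rintro f -
    induction f using Finsupp.induction_linear with
    | zero => exact Submodule.zero_mem _
    | add f g hf hg => exact Submodule.add_mem _ hf hg
    | single π r =>
      obtain ⟨x, u, hx, hu⟩ := exists_action_single hw π
      refine ⟨r • x, ?_⟩
      rw [map_smul, hev, hx, Finsupp.mapDomain_single, hu, Finsupp.smul_single, smul_eq_mul,
        mul_one]
  have := Hecke0.finite (n - 1)
  have h2 := ev.finrank_range_add_finrank_ker
  have h3 := Hecke0.finrank_le (n - 1)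
  rw [LinearMap.range_eq_top.2 hsurj, finrank_top, Module.finrank_finsupp_self,
    Fintype.card_perm, Fintype.card_fin] at h2
  -- The image already has dimension `(n - 1)!`, the upper bound for the whole algebra, so nothing
  -- is left for the kernel.
  have h4 : LinearMap.ker ev = ⊥ := Submodule.finrank_eq_zero.1 (by omega)
  intro x y hxy
  apply LinearMap.ker_eq_bot.1 h4
  rw [hev, hev, hxy]

end NoncrossingChains

theorem mainTheorem3 (n : ℕ) (hn : 1 ≤ n) :
    -- the weak order is a partial order
    IsPartialOrder (F n) weakLE ∧
    -- the down operators are well defined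
    (∀ (i : Fin (n - 1 - 1)) (w : F n),
      (IsDescent (phi w) i → weakLT (R i w) w ∨ weakLT (L i w) w) ∧
      (IsDescent (phi w) i → weakLT (R i w) w → down i w = R i w) ∧
      (IsDescent (phi w) i → weakLT (L i w) w → down i w = L i w) ∧
      (¬ IsDescent (phi w) i → down i w = w)) ∧
    -- the down operators satisfy the relations of the `0`-Hecke algebra
    (∀ (i : Fin (n - 1 - 1)) (w : F n), down i (down i w) = down i w) ∧
    (∀ i j : Fin (n - 1 - 1), (i.1 + 1 < j.1 ∨ j.1 + 1 < i.1) →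
      ∀ w : F n, down i (down j w) = down j (down i w)) ∧
    (∀ i j : Fin (n - 1 - 1), j.1 = i.1 + 1 →
      ∀ w : F n, down i (down j (down i w)) = down j (down i (down j w))) ∧
    -- every lower interval is invariant under the down operators
    (∀ (w v : F n) (i : Fin (n - 1 - 1)), v ∈ lowerInterval w → down i v ∈ lowerInterval w) ∧
    -- the resulting action of the algebra is faithful, and lower intervals are invariant
    ∃ ρ : Hecke0 (n - 1) →ₐ[ℚ] Module.End ℚ (F n →₀ ℚ),
      (∀ (i : Fin (n - 1 - 1)) (w : F n),
        ρ (Hecke0.T i) (Finsupp.single w 1) = Finsupp.single (down i w) 1) ∧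
      Function.Injective ρ ∧
      ∀ (w : F n) (x : Hecke0 (n - 1)),
        ∀ f ∈ Finsupp.supported ℚ ℚ (lowerInterval w),
          ρ x f ∈ Finsupp.supported ℚ ℚ (lowerInterval w) := by
  refine ⟨isPartialOrder_weakLE n, fun i w => ⟨weakLT_R_or_weakLT_L,
    (agreeOff_R i.1 w).down_eq_of_weakLT, (agreeOff_L i.1 w).down_eq_of_weakLT,
    down_of_not_isDescent⟩, fun i w => down_down i.1 w, fun i j h w => down_comm h w, ?_,
    fun w v i => down_mem_lowerInterval i.1, action n, ?_, action_injective n,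
    action_mem_supported⟩
  · intro i j h w
    rw [h]
    exact down_braid (by omega) w
  · intro i w
    rw [action_T, downEnd_single]
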